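/- **Lemma 2.2.** Let $S$ be a compact smooth manifold, possibly with boundary (or corners), let $\omega$ be a symplectic form on $S$, and let $h$ be a symplectomorphism of $(S,\omega)$, i.e. a diffeomorphism with $h^*\omega=\omega$. Let $K$ be the kernel of $h_*-\mathrm{id}$ on $H_1(S;\mathbb{Z})$ and let $\Gamma\subset\mathbb{R}$ be the group of integrals of $\omega$ over $2$-cycles. The flux of $h$ is the map $F_h:K\to\mathbb{R}/\Gamma$ given by $F_h([\gamma])=\int_C\omega \bmod \Gamma$, where $C$ is any $2$-chain in $S$ with $\partial C=h(\gamma)-\gamma$; the flux is nonzero if $F_h$ is not identically zero. Let $\Sigma(S,h)=(S\times[0,1])/(x,1)\sim(h(x),0)$ be the mapping torus, with the smooth structure of $(S\times\mathbb{R})/\big((x,t)\sim(h(x),t-1)\big)$, where $t$ is the coordinate on $\mathbb{R}$, and let $\omega_h$ be the $2$-form on $\Sigma(S,h)$ whose pullback to $S\times\mathbb{R}$ is the pullback of $\omega$ under the projection $S\times\mathbb{R}\to S$. Suppose that $\omega$ is exact and that the flux of $h$ is nonzero. Then $\omega_h$ is smooth and closed, and its cohomology class $[\omega_h]\in H^2(\Sigma(S,h);\mathbb{R})$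 is nonzero. Hence $h$ is not the first return map of a Reeb vector field: there is no contact form $\alpha$ on $\Sigma(S,h)$ such that $d\alpha|_{S\times\{0\}}=\omega$ and such that the Reeb vector field $R_\alpha$ is everywhere a multiple of $\partial_t$. -/

import Mathlib

open scoped Manifold ContDiff Topology

noncomputable section

/-! ## Differential forms on manifolds with corners, exterior derivative, de Rham cohomology -/

section Forms

variable {E : Type*} [NormedAddCommGroup E] [NormedSpace ℝ E] {H : Type*} [TopologicalSpace H]
  (I : ModelWithCorners ℝ E H) (M : Type*) [TopologicalSpace M] [ChartedSpace H M]

/-- Differential `k`-forms on `M`, without any regularity condition: a choice of an alternating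
`k`-linear form on every tangent space. -/
def DiffForm (k : ℕ) : Type _ := (x : M) → TangentSpace I x [⋀^Fin k]→L[ℝ] ℝ

instance (k : ℕ) : AddCommGroup (DiffForm I M k) :=
  inferInstanceAs (AddCommGroup ((x : M) → TangentSpace I x [⋀^Fin k]→L[ℝ] ℝ))

instance (k : ℕ) : Module ℝ (DiffForm I M k) :=
  inferInstanceAs (Module ℝ ((x : M) → TangentSpace I x [⋀^Fin k]→L[ℝ] ℝ))

variable {I M}

namespace DiffForm

/-- The expression of the form `Ω` in the preferred chart at `x₀`: the pullback of `Ω` under the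
inverse of the chart, as a form on (the range of the model in) the vector space `E`. -/
def inChart {k : ℕ} (Ω : DiffForm I M k) (x₀ : M) (y : E) : E [⋀^Fin k]→L[ℝ] ℝ :=
  (Ω ((extChartAt I x₀).symm y)).compContinuousLinearMap
    (mfderivWithin 𝓘(ℝ, E) I (extChartAt I x₀).symm (Set.range I) y)

/-- A form is smooth if its expression in every preferred chart is smooth. -/
def Smooth {k : ℕ} (Ω : DiffForm I M k) : Prop :=
  ∀ x₀ : M, ContDiffOn ℝ ∞ (Ω.inChart x₀) (extChartAt I x₀).target

/-- The exterior derivative: at `x` it is computed in the preferred chart at `x`. -/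
def extD {k : ℕ} (Ω : DiffForm I M k) : DiffForm I M (k + 1) := fun x =>
  (extDerivWithin (Ω.inChart x) (Set.range I) (extChartAt I x x)).compContinuousLinearMap
    (mfderiv I 𝓘(ℝ, E) (extChartAt I x) x)

/-- The pullback of a form under a map. -/
def pullback {E' : Type*} [NormedAddCommGroup E'] [NormedSpace ℝ E'] {H' : Type*}
    [TopologicalSpace H'] {J : ModelWithCorners ℝ E' H'} {N : Type*} [TopologicalSpace N]
    [ChartedSpace H' N] {k : ℕ} (f : M → N) (Ω : DiffForm J N k) : DiffForm I M k := fun x =>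
  (Ω (f x)).compContinuousLinearMap (mfderiv I J f x)

lemma inChart_add {k : ℕ} (Ω η : DiffForm I M k) (x₀ : M) :
    (Ω + η).inChart x₀ = Ω.inChart x₀ + η.inChart x₀ := by
  ext y v; rfl

lemma inChart_smul {k : ℕ} (c : ℝ) (Ω : DiffForm I M k) (x₀ : M) :
    (c • Ω).inChart x₀ = c • Ω.inChart x₀ := by
  ext y v; rfl

lemma inChart_zero {k : ℕ} (x₀ : M) : (0 : DiffForm I M k).inChart x₀ = 0 := by
  ext y v; rfl

lemma Smooth.add {k : ℕ} {Ω η : DiffForm I M k} (hΩ : Ω.Smooth) (hη : η.Smooth) :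
    (Ω + η).Smooth := fun x₀ => by
  rw [inChart_add]; exact (hΩ x₀).add (hη x₀)

lemma Smooth.smul {k : ℕ} (c : ℝ) {Ω : DiffForm I M k} (hΩ : Ω.Smooth) :
    (c • Ω).Smooth := fun x₀ => by
  rw [inChart_smul]; exact contDiffOn_const.smul (hΩ x₀)

lemma smooth_zero {k : ℕ} : (0 : DiffForm I M k).Smooth := fun x₀ => by
  rw [inChart_zero]; exact contDiffOn_const

lemma Smooth.differentiableWithinAt {k : ℕ} {Ω : DiffForm I M k} (hΩ : Ω.Smooth) (x : M) :
    DifferentiableWithinAt ℝ (Ω.inChart x) (Set.range I) (extChartAt I x x) :=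
  (((hΩ x) _ (mem_extChartAt_target x)).mono_of_mem_nhdsWithin
    (extChartAt_target_mem_nhdsWithin x)).differentiableWithinAt (by simp)

lemma extD_add {k : ℕ} {Ω η : DiffForm I M k} (hΩ : Ω.Smooth) (hη : η.Smooth) :
    (Ω + η).extD = Ω.extD + η.extD := by
  funext x
  have hu : UniqueDiffWithinAt ℝ (Set.range I) (extChartAt I x x) :=
    I.uniqueDiffOn _ (extChartAt_target_subset_range x (mem_extChartAt_target x))
  rw [extD, inChart_add, extDerivWithin_add hu (hΩ.differentiableWithinAt x) (hη.differentiableWithinAt x)]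
  rfl

lemma extD_smul {k : ℕ} (c : ℝ) (Ω : DiffForm I M k) : (c • Ω).extD = c • Ω.extD := by
  funext x
  have hu : UniqueDiffWithinAt ℝ (Set.range I) (extChartAt I x x) :=
    I.uniqueDiffOn _ (extChartAt_target_subset_range x (mem_extChartAt_target x))
  rw [extD, inChart_smul, extDerivWithin_smul c _ hu]
  rfl

lemma extD_zero {k : ℕ} : (0 : DiffForm I M k).extD = 0 := by
  simpa using extD_smul (0 : ℝ) (0 : DiffForm I M k)

lemma pullback_id {k : ℕ} (Ω : DiffForm I M k) : pullback (fun x => x) Ω = Ω := by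
  funext x
  have : mfderiv I I (fun x : M => x) x = ContinuousLinearMap.id ℝ _ := mfderiv_id
  ext v
  simp [pullback, this]

lemma pullback_comp {E' : Type*} [NormedAddCommGroup E'] [NormedSpace ℝ E'] {H' : Type*}
    [TopologicalSpace H'] {J : ModelWithCorners ℝ E' H'} {N : Type*} [TopologicalSpace N]
    [ChartedSpace H' N] {E'' : Type*} [NormedAddCommGroup E''] [NormedSpace ℝ E''] {H'' : Type*}
    [TopologicalSpace H''] {J' : ModelWithCorners ℝ E'' H''} {P : Type*} [TopologicalSpace P]
    [ChartedSpace H'' P] {k : ℕ} (Ω : DiffForm J' P k) {g : N → P} {f : M → N}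
    (hg : MDifferentiable J J' g) (hf : MDifferentiable I J f) :
    pullback (I := I) (g ∘ f) Ω = pullback f (pullback (I := J) g Ω) := by
  funext x
  ext v
  simp only [pullback, mfderiv_comp x (hg (f x)) (hf x)]
  rfl

end DiffForm

variable (I M)

/-- The vector space of smooth closed `k`-forms. -/
def closedForms (k : ℕ) : Submodule ℝ (DiffForm I M k) where
  carrier := {Ω | Ω.Smooth ∧ Ω.extD = 0}
  add_mem' ha hb := ⟨ha.1.add hb.1, by rw [DiffForm.extD_add ha.1 hb.1, ha.2, hb.2, add_zero]⟩
  zero_mem' := ⟨DiffForm.smooth_zero, DiffForm.extD_zero⟩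
  smul_mem' c _ ha := ⟨ha.1.smul c, by rw [DiffForm.extD_smul, ha.2, smul_zero]⟩

/-- The vector space of exact `k`-forms, i.e. exterior derivatives of smooth forms. -/
def exactForms : (k : ℕ) → Submodule ℝ (DiffForm I M k)
  | 0 => ⊥
  | k + 1 =>
    { carrier := {Ω | ∃ β : DiffForm I M k, β.Smooth ∧ Ω = β.extD}
      add_mem' := by
        rintro _ _ ⟨a, ha, rfl⟩ ⟨b, hb, rfl⟩
        exact ⟨a + b, ha.add hb, (DiffForm.extD_add ha hb).symm⟩
      zero_mem' := ⟨0, DiffForm.smooth_zero, DiffForm.extD_zero.symm⟩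
      smul_mem' := by
        rintro c _ ⟨a, ha, rfl⟩
        exact ⟨c • a, ha.smul c, (DiffForm.extD_smul c a).symm⟩ }

/-- De Rham cohomology `H^k(M; ℝ)`: closed forms modulo exact forms. -/
def DeRham (k : ℕ) : Type _ :=
  closedForms I M k ⧸ (exactForms I M k).submoduleOf (closedForms I M k)

instance (k : ℕ) : AddCommGroup (DeRham I M k) :=
  inferInstanceAs (AddCommGroup (closedForms I M k ⧸ (exactForms I M k).submoduleOf
    (closedForms I M k)))

variable {I M}

/-- The de Rham cohomology class of a closed form. -/
def deRhamClass {k : ℕ} (Ω : closedForms I M k) : DeRham I M k :=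
  Submodule.Quotient.mk Ω

/-- A symplectic form: a smooth, closed, everywhere nondegenerate `2`-form. -/
structure IsSymplecticForm (Ω : DiffForm I M 2) : Prop where
  closed : Ω ∈ closedForms I M 2
  nondegenerate : ∀ (x : M) (v : TangentSpace I x),
    (∀ w : TangentSpace I x, Ω x ![v, w] = 0) → v = 0

/-- A contact form: a smooth nowhere vanishing `1`-form `α` such that `dα` is nondegenerate on
the hyperplane `ker α` at every point. -/
structure IsContactForm (α : DiffForm I M 1) : Prop where
  smooth : α.Smooth
  ne_zero : ∀ x : M, α x ≠ 0
  nondegenerate : ∀ (x : M) (v : TangentSpace I x), α x ![v] = 0 →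
    (∀ w : TangentSpace I x, α x ![w] = 0 → α.extD x ![v, w] = 0) → v = 0

/-- `R` is the Reeb vector field of the contact form `α`: `α(R) = 1` and `ι_R dα = 0`. -/
def IsReebField (α : DiffForm I M 1) (R : (x : M) → TangentSpace I x) : Prop :=
  ∀ x : M, α x ![R x] = 1 ∧ ∀ w : TangentSpace I x, α.extD x ![R x, w] = 0

end Forms

/-! ## Smooth singular chains -/

section Chains

/-- The standard `k`-simplex in `ℝ^k`, with vertices `0, e₁, …, e_k`. -/
def stdSimp (k : ℕ) : Set (Fin k → ℝ) := {x | (∀ i, 0 ≤ x i) ∧ ∑ i, x i ≤ 1}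

/-- The barycentric coordinates of a point with respect to the vertices `0, e₁, …, e_k`. -/
def baryCoord {k : ℕ} (x : Fin k → ℝ) : Fin (k + 1) → ℝ := Fin.cons (1 - ∑ i, x i) x

/-- The `i`-th face inclusion of the standard `k`-simplex into the standard `k+1`-simplex: the
affine map sending the `m`-th vertex to the `i.succAbove m`-th vertex. -/
def faceIncl {k : ℕ} (i : Fin (k + 2)) (x : Fin k → ℝ) : Fin (k + 1) → ℝ := fun j =>
  ∑ m : Fin (k + 1), if i.succAbove m = j.succ then baryCoord x m else 0

lemma zero_mem_stdSimp (k : ℕ) : (0 : Fin k → ℝ) ∈ stdSimp k := by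
  simp [stdSimp]

lemma baryCoord_nonneg {k : ℕ} {x : Fin k → ℝ} (hx : x ∈ stdSimp k) (m : Fin (k + 1)) :
    0 ≤ baryCoord x m := by
  refine Fin.cases ?_ (fun j => ?_) m
  · simpa [baryCoord] using hx.2
  · simpa [baryCoord] using hx.1 j

lemma sum_baryCoord {k : ℕ} (x : Fin k → ℝ) : ∑ m, baryCoord x m = 1 := by
  simp [baryCoord, Fin.sum_univ_succ]

lemma faceIncl_mem {k : ℕ} (i : Fin (k + 2)) {x : Fin k → ℝ} (hx : x ∈ stdSimp k) :
    faceIncl i x ∈ stdSimp (k + 1) := by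
  refine ⟨fun j => Finset.sum_nonneg fun m _ => ?_, ?_⟩
  · split_ifs
    exacts [baryCoord_nonneg hx m, le_rfl]
  · rw [← sum_baryCoord x]
    simp only [faceIncl]
    rw [Finset.sum_comm]
    refine Finset.sum_le_sum fun m _ => ?_
    by_cases h : i.succAbove m = 0
    · simp [h, (Fin.succ_ne_zero _).symm, baryCoord_nonneg hx m]
    · obtain ⟨j, hj⟩ := Fin.exists_succ_eq.2 h
      simp [← hj]

lemma contDiff_faceIncl {k : ℕ} (i : Fin (k + 2)) : ContDiff ℝ ∞ (faceIncl (k := k) i) := by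
  refine contDiff_pi.2 fun j => ContDiff.sum fun m _ => ?_
  split_ifs
  · refine Fin.cases ?_ (fun l => ?_) m
    · simp only [baryCoord, Fin.cons_zero]; fun_prop
    · simp only [baryCoord, Fin.cons_succ]; fun_prop
  · exact contDiff_const

variable {E : Type*} [NormedAddCommGroup E] [NormedSpace ℝ E] {H : Type*} [TopologicalSpace H]
  (I : ModelWithCorners ℝ E H) (M : Type*) [TopologicalSpace M] [ChartedSpace H M]

/-- A smooth singular `k`-simplex in `M`: a smooth map from the standard `k`-simplex to `M`. It is
written as a map on all of `ℝ^k` with an irrelevant constant value outside the simplex, so that two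
of them are equal as soon as they agree on the simplex. -/
@[ext] structure SmoothSimplex (k : ℕ) where
  toFun : (Fin k → ℝ) → M
  smooth : ContMDiffOn 𝓘(ℝ, Fin k → ℝ) I ∞ toFun (stdSimp k)
  junk : ∀ x, x ∉ stdSimp k → toFun x = toFun 0

/-- Smooth singular `k`-chains with integer coefficients. -/
abbrev SmoothChain (k : ℕ) : Type _ := SmoothSimplex I M k →₀ ℤ

variable {I M}

open Classical in
/-- The `i`-th face of a smooth singular simplex. -/
def SmoothSimplex.face {k : ℕ} (σ : SmoothSimplex I M (k + 1)) (i : Fin (k + 2)) :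
    SmoothSimplex I M k where
  toFun x := if x ∈ stdSimp k then σ.toFun (faceIncl i x) else σ.toFun (faceIncl i 0)
  smooth := by
    have h := σ.smooth.comp (contDiff_faceIncl i).contMDiff.contMDiffOn
      (fun x hx => faceIncl_mem i hx)
    exact h.congr fun x hx => if_pos hx
  junk x hx := by rw [if_neg hx, if_pos (zero_mem_stdSimp k)]

/-- The boundary operator `∂ σ = ∑ (-1)^i σ|_{i-th face}`, extended linearly. -/
def boundary (k : ℕ) : SmoothChain I M (k + 1) →+ SmoothChain I M k :=
  Finsupp.liftAddHom fun σ => ∑ i : Fin (k + 2),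
    (-1 : ℤ) ^ (i : ℕ) • Finsupp.singleAddHom (σ.face i)

variable {E' : Type*} [NormedAddCommGroup E'] [NormedSpace ℝ E'] {H' : Type*} [TopologicalSpace H']
  {J : ModelWithCorners ℝ E' H'} {N : Type*} [TopologicalSpace N] [ChartedSpace H' N]

/-- The image of a smooth simplex under a smooth map. -/
def SmoothSimplex.map {k : ℕ} (f : M → N) (hf : ContMDiff I J ∞ f) (σ : SmoothSimplex I M k) :
    SmoothSimplex J N k where
  toFun := f ∘ σ.toFun
  smooth := hf.comp_contMDiffOn σ.smooth
  junk x hx := by simp [σ.junk x hx]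

/-- The map induced on chains by a smooth map. -/
def chainMap (f : M → N) (hf : ContMDiff I J ∞ f) (k : ℕ) : SmoothChain I M k →+ SmoothChain J N k :=
  Finsupp.mapDomain.addMonoidHom (SmoothSimplex.map f hf)

lemma boundary_chainMap (f : M → N) (hf : ContMDiff I J ∞ f) (k : ℕ) (c : SmoothChain I M (k + 1)) :
    boundary k (chainMap f hf (k + 1) c) = chainMap f hf k (boundary k c) := by
  classical
  have key : (boundary k).comp (chainMap f hf (k + 1))
      = (chainMap f hf k).comp (boundary (I := I) (M := M) k) := by
    ext1 σ
    ext1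
    have hface : ∀ i, (σ.map f hf).face i = (σ.face i).map f hf := fun i => by
      ext x
      simp only [SmoothSimplex.face, SmoothSimplex.map, Function.comp]
      split_ifs <;> rfl
    simp [boundary, chainMap, Finsupp.mapDomain_single, hface, map_sum]
  exact DFunLike.congr_fun key c

/-- The integral of a `k`-form over a smooth singular `k`-simplex. -/
def SmoothSimplex.integral {k : ℕ} (Ω : DiffForm I M k) (σ : SmoothSimplex I M k) : ℝ :=
  ∫ x in stdSimp k, Ω (σ.toFun x) fun j =>
    mfderivWithin 𝓘(ℝ, Fin k → ℝ) I σ.toFun (stdSimp k) x (Pi.single j (1 : ℝ) : Fin k → ℝ)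

/-- The integral of a `k`-form over a smooth singular `k`-chain. -/
def chainIntegral {k : ℕ} (Ω : DiffForm I M k) : SmoothChain I M k →+ ℝ :=
  Finsupp.liftAddHom fun σ => (zmultiplesHom ℝ) (σ.integral Ω)

variable (I M)

/-- Smooth singular `1`-cycles. -/
def oneCycles : AddSubgroup (SmoothChain I M 1) := (boundary 0).ker

/-- Smooth singular `1`-boundaries. -/
def oneBoundaries : AddSubgroup (SmoothChain I M 1) := (boundary 1).range

/-- The first homology group `H₁(M; ℤ)`, computed with smooth singular chains. -/
abbrev HomologyOne : Type _ := oneCycles I M ⧸ (oneBoundaries I M).addSubgroupOf (oneCycles I M)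

variable {I M}

/-- The map induced by a smooth map on `1`-cycles. -/
def oneCyclesMap (f : M → N) (hf : ContMDiff I J ∞ f) : oneCycles I M →+ oneCycles J N :=
  (chainMap f hf 1).restrict fun γ (hγ : boundary 0 γ = 0) => by
    change boundary 0 (chainMap f hf 1 γ) = 0
    rw [boundary_chainMap, hγ, map_zero]

/-- The map `f_* : H₁(M; ℤ) → H₁(N; ℤ)` induced by a smooth map. -/
def homologyOneMap (f : M → N) (hf : ContMDiff I J ∞ f) : HomologyOne I M →+ HomologyOne J N :=
  QuotientAddGroup.map _ _ (oneCyclesMap f hf) <| by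
    rintro γ ⟨D, hD⟩
    exact ⟨chainMap f hf 2 D, by rw [boundary_chainMap, hD]; rfl⟩

end Chains

/-! ## The flux of a symplectomorphism -/

section Flux

variable {E : Type*} [NormedAddCommGroup E] [NormedSpace ℝ E] {H : Type*} [TopologicalSpace H]
  {I : ModelWithCorners ℝ E H} {M : Type*} [TopologicalSpace M] [ChartedSpace H M]

/-- A diffeomorphism preserving the form `Ω`. -/
def IsSymplectomorphism (Ω : DiffForm I M 2) (h : M ≃ₘ⟮I, I⟯ M) : Prop :=
  DiffForm.pullback h Ω = Ω

/-- The group `Γ` of periods of `Ω`, generated by (hence consisting of) the integrals of `Ω` over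
`2`-cycles. -/
def periods (Ω : DiffForm I M 2) : AddSubgroup ℝ := (boundary 1).ker.map (chainIntegral Ω)

/-- The kernel `K` of `h_* - id` on `H₁(M; ℤ)`. -/
def invariantHomology (h : M ≃ₘ⟮I, I⟯ M) : AddSubgroup (HomologyOne I M) :=
  (homologyOneMap h h.contMDiff - AddMonoidHom.id _).ker

/-- `c` represents the homology class `κ`, and `C` is a `2`-chain with boundary `h(c) - c`. -/
def IsCobordism (h : M ≃ₘ⟮I, I⟯ M) (κ : HomologyOne I M) (c : oneCycles I M)
    (C : SmoothChain I M 2) : Prop :=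
  (QuotientAddGroup.mk c : HomologyOne I M) = κ ∧
    boundary 1 C = chainMap h h.contMDiff 1 c - (c : SmoothChain I M 1)

lemma exists_isCobordism (h : M ≃ₘ⟮I, I⟯ M) (κ : invariantHomology h) :
    ∃ p : oneCycles I M × SmoothChain I M 2, IsCobordism h κ p.1 p.2 := by
  obtain ⟨κ, hκ⟩ := κ
  obtain ⟨c, rfl⟩ := QuotientAddGroup.mk_surjective κ
  have h1 : homologyOneMap h h.contMDiff (QuotientAddGroup.mk c) = QuotientAddGroup.mk c :=
    sub_eq_zero.1 hκ
  have h2 : (QuotientAddGroup.mk (oneCyclesMap h h.contMDiff c) : HomologyOne I M)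
      = QuotientAddGroup.mk c := h1
  obtain ⟨C, hC⟩ := QuotientAddGroup.eq.1 h2.symm
  refine ⟨(c, C), rfl, ?_⟩
  rw [hC, sub_eq_neg_add]
  rfl

/-- The flux `F_h : K → ℝ / Γ`, sending the class of a cycle `c` to the integral of `Ω` over a
`2`-chain with boundary `h(c) - c`. The result does not depend on the cycle and the chain chosen
here, see `flux_eq`. -/
def flux (Ω : DiffForm I M 2) (h : M ≃ₘ⟮I, I⟯ M) (κ : invariantHomology h) : ℝ ⧸ periods Ω :=
  QuotientAddGroup.mk (chainIntegral Ω (exists_isCobordism h κ).choose.2)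

/-- The flux is nonzero: its image is not `{0}`. -/
def FluxNonzero (Ω : DiffForm I M 2) (h : M ≃ₘ⟮I, I⟯ M) : Prop :=
  ∃ κ : invariantHomology h, flux Ω h κ ≠ 0

lemma uniqueDiffOn_stdSimp (k : ℕ) : UniqueDiffOn ℝ (stdSimp k) := by
  refine uniqueDiffOn_convex ?_ ?_
  · intro x hx y hy a b ha hb hab
    refine ⟨fun i => ?_, ?_⟩
    · have h1 := mul_nonneg ha (hx.1 i)
      have h2 := mul_nonneg hb (hy.1 i)
      simpa using add_nonneg h1 h2
    · have h1 := mul_le_mul_of_nonneg_left hx.2 ha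
      have h2 := mul_le_mul_of_nonneg_left hy.2 hb
      simp only [Pi.add_apply, Pi.smul_apply, smul_eq_mul, Finset.sum_add_distrib,
        ← Finset.mul_sum]
      linarith
  · have hopen : IsOpen {x : Fin k → ℝ | (∀ i, 0 < x i) ∧ ∑ i, x i < 1} := by
      simp only [Set.ofPred_and, Set.ofPred_forall]
      exact (isOpen_iInter_of_finite fun i => isOpen_lt continuous_const (continuous_apply i)).inter
        (isOpen_lt (by fun_prop) continuous_const)
    refine ⟨fun _ => 1 / ((k : ℝ) + 1), mem_interior.2 ⟨_, ?_, hopen, ?_⟩⟩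
    · exact fun x hx => ⟨fun i => (hx.1 i).le, hx.2.le⟩
    · refine ⟨fun i => by positivity, ?_⟩
      simp only [Finset.sum_const, Finset.card_univ, Fintype.card_fin, nsmul_eq_mul]
      rw [mul_one_div, div_lt_one (by positivity)]
      linarith

lemma measurableSet_stdSimp (k : ℕ) : MeasurableSet (stdSimp k) := by
  have : IsClosed (stdSimp k) := by
    simp only [stdSimp, Set.ofPred_and, Set.ofPred_forall]
    exact (isClosed_iInter fun i => isClosed_le continuous_const (continuous_apply i)).inter
      (isClosed_le (by fun_prop) continuous_const)
  exact this.measurableSet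

lemma SmoothSimplex.integral_map {k : ℕ} (Ω : DiffForm I M k) (f : M → M)
    (hf : ContMDiff I I ∞ f) (σ : SmoothSimplex I M k) :
    (σ.map f hf).integral Ω = σ.integral (DiffForm.pullback f Ω) := by
  refine MeasureTheory.setIntegral_congr_fun (measurableSet_stdSimp k) fun x hx => ?_
  have hcomp := mfderivWithin_comp (I := 𝓘(ℝ, Fin k → ℝ)) (I' := I) (I'' := I) (u := Set.univ) x
    ((hf (σ.toFun x)).mdifferentiableAt (by simp)).mdifferentiableWithinAt
    ((σ.smooth x hx).mdifferentiableWithinAt (by simp)) (Set.subset_univ _)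
    (uniqueDiffOn_stdSimp k x hx).uniqueMDiffWithinAt
  rw [mfderivWithin_univ] at hcomp
  have h2 : ∀ v : Fin k → ℝ, mfderivWithin 𝓘(ℝ, Fin k → ℝ) I (f ∘ σ.toFun) (stdSimp k) x v
      = mfderiv I I f (σ.toFun x) (mfderivWithin 𝓘(ℝ, Fin k → ℝ) I σ.toFun (stdSimp k) x v) :=
    fun v => DFunLike.congr_fun hcomp v
  change Ω (f (σ.toFun x)) _ = Ω (f (σ.toFun x)) _
  congr 1
  funext j
  exact h2 _

lemma chainIntegral_chainMap {Ω : DiffForm I M 2} {h : M ≃ₘ⟮I, I⟯ M}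
    (hh : IsSymplectomorphism Ω h) (D : SmoothChain I M 2) :
    chainIntegral Ω (chainMap h h.contMDiff 2 D) = chainIntegral Ω D := by
  have key : (chainIntegral Ω).comp (chainMap h h.contMDiff 2) = chainIntegral Ω := by
    ext1 σ
    ext1
    have := σ.integral_map Ω h h.contMDiff
    rw [hh] at this
    simp [chainIntegral, chainMap, Finsupp.mapDomain_single, this]
  exact DFunLike.congr_fun key D

/-- The flux along a homology class may be computed with any representing cycle and any chain. -/
theorem flux_eq {Ω : DiffForm I M 2} {h : M ≃ₘ⟮I, I⟯ M} (hh : IsSymplectomorphism Ω h)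
    (κ : invariantHomology h) {c : oneCycles I M} {C : SmoothChain I M 2}
    (hC : IsCobordism h κ c C) : flux Ω h κ = QuotientAddGroup.mk (chainIntegral Ω C) := by
  have hC' := (exists_isCobordism h κ).choose_spec
  set c' := (exists_isCobordism h κ).choose.1
  set C' := (exists_isCobordism h κ).choose.2
  obtain ⟨D, hD⟩ := QuotientAddGroup.eq.1 (hC'.1.trans hC.1.symm)
  have hD : boundary 1 D = -(c' : SmoothChain I M 1) + c := hD
  refine QuotientAddGroup.eq.2 ⟨-C' + C - (chainMap h h.contMDiff 2 D - D), ?_, ?_⟩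
  · change boundary 1 _ = 0
    rw [map_sub, map_add, map_neg, map_sub, boundary_chainMap, hD, hC.2, hC'.2, map_add, map_neg]
    abel
  · rw [map_sub, map_add, map_neg, map_sub, chainIntegral_chainMap hh, sub_self, sub_zero]

end Flux

/-! ## The mapping torus -/

section QuotientManifold

variable {E : Type*} [NormedAddCommGroup E] [NormedSpace ℝ E] {H : Type*} [TopologicalSpace H]
  (I : ModelWithCorners ℝ E H) {X : Type*} [TopologicalSpace X] [ChartedSpace H X]
  {Y : Type*} [TopologicalSpace Y] {f : X → Y}

/-- Any two points of a fibre of `f` are exchanged by a smooth map over `f`. -/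
def HasSmoothDeckMaps (f : X → Y) : Prop :=
  ∀ x y : X, f x = f y → ∃ g : X → X, ContMDiff I I ∞ g ∧ g x = y ∧ ∀ z, f (g z) = f z

variable {I}

/-- A local inverse of `f` composed with `f` is locally a deck map. -/
lemma IsLocalHomeomorph.localInverse_comp_eventuallyEq (hf : IsLocalHomeomorph f)
    (hd : HasSmoothDeckMaps I f) (a x : X) (hx : f x ∈ (hf.localInverseAt a).source) :
    ∃ g : X → X, ContMDiff I I ∞ g ∧ g x = hf.localInverseAt a (f x) ∧
      ∀ᶠ z in 𝓝 x, hf.localInverseAt a (f z) = g z := by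
  obtain ⟨g, hg, hgx, hfg⟩ := hd x (hf.localInverseAt a (f x))
    (hf.apply_localInverseAt_of_mem hx).symm
  refine ⟨g, hg, hgx, ?_⟩
  have h1 : ∀ᶠ z in 𝓝 x, f z ∈ (hf.localInverseAt a).source :=
    hf.continuous.continuousAt.eventually ((hf.localInverseAt a).open_source.mem_nhds hx)
  have h2 : ∀ᶠ z in 𝓝 x, g z ∈ (hf.localInverseAt a).target :=
    hg.continuous.continuousAt.eventually ((hf.localInverseAt a).open_target.mem_nhds
      (by rw [hgx]; exact (hf.localInverseAt a).map_source hx))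
  filter_upwards [h1, h2] with z hz1 hz2
  refine hf.injOn_localInverseAt_target ((hf.localInverseAt a).map_source hz1) hz2 ?_
  rw [hf.apply_localInverseAt_of_mem hz1, hfg]

/-- The quotient of a manifold by a surjective local homeomorphism with smooth deck maps is a
manifold. -/
lemma IsLocalHomeomorph.isManifold_chartedSpace [IsManifold I ∞ X] (hf : IsLocalHomeomorph f)
    (hs : Function.Surjective f) (hd : HasSmoothDeckMaps I f) :
    letI := hf.chartedSpace (H := H) hs
    IsManifold I ∞ Y := by
  let _ := hf.chartedSpace (H := H) hs
  refine isManifold_of_contDiffOn I ∞ Y ?_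
  rintro _ _ ⟨a, rfl⟩ ⟨b, rfl⟩
  set a' := hs.hasRightInverse.choose a
  set b' := hs.hasRightInverse.choose b
  set La := hf.localInverseAt a' with hLa
  set Lb := hf.localInverseAt b' with hLb
  set ca := chartAt H a'
  set cb := chartAt H b'
  rw [← contMDiffOn_iff_contDiffOn]
  have hmain : ContMDiffOn I I ∞ ((La.trans ca).symm.trans (Lb.trans cb))
      ((La.trans ca).symm.trans (Lb.trans cb)).source := by
    intro y hy
    have hy1 : y ∈ ca.target := by simp at hy; exact hy.1.1
    have hy2 : f (ca.symm y) ∈ Lb.source := by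
      simp [hLa] at hy; exact hy.2.1
    have hy3 : Lb (f (ca.symm y)) ∈ cb.source := by
      simp [hLa] at hy; exact hy.2.2
    obtain ⟨g, hg, hgx, hev⟩ := hf.localInverse_comp_eventuallyEq hd b' (ca.symm y) hy2
    have hca : ContMDiffAt I I ∞ ca.symm y :=
      (contMDiffOn_chart_symm (I := I) (x := a') y hy1).contMDiffAt (ca.open_target.mem_nhds hy1)
    have hcb : ContMDiffAt I I ∞ cb (g (ca.symm y)) := by
      have hgs : g (ca.symm y) ∈ cb.source := by rw [hgx]; exact hy3
      exact (contMDiffOn_chart (I := I) (x := b') _ hgs).contMDiffAt (cb.open_source.mem_nhds hgs)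
    have hcomp : ContMDiffAt I I ∞ (cb ∘ g ∘ ca.symm) y := hcb.comp y ((hg _).comp y hca)
    refine (hcomp.congr_of_eventuallyEq ?_).contMDiffWithinAt
    filter_upwards [hca.continuousAt.eventually hev] with z hz
    simp [hLa, ← hz, hLb]
  apply I.contMDiff.comp_contMDiffOn
  exact hmain.comp (I.contMDiffOn_symm.mono (by simp)) (fun z hz => hz.1)

/-- A surjective local homeomorphism with smooth deck maps is a local diffeomorphism onto the
quotient manifold. -/
lemma IsLocalHomeomorph.isLocalDiffeomorph_chartedSpace [IsManifold I ∞ X]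
    (hf : IsLocalHomeomorph f) (hs : Function.Surjective f) (hd : HasSmoothDeckMaps I f) :
    letI := hf.chartedSpace (H := H) hs
    IsLocalDiffeomorph I I ∞ f := by
  let _ := hf.chartedSpace (H := H) hs
  have : IsManifold I ∞ Y := hf.isManifold_chartedSpace hs hd
  set r := hs.hasRightInverse.choose with hr
  have hrr : ∀ q, f (r q) = q := hs.hasRightInverse.choose_spec
  have hchart : ∀ q, chartAt H q = (hf.localInverseAt (r q)).trans (chartAt H (r q)) :=
    fun q => rfl
  have hsrc : ∀ q, q ∈ (hf.localInverseAt (r q)).source := fun q => by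
    have := hf.apply_self_mem_localInverseAt_source (x := r q)
    rwa [hrr] at this
  have hval : ∀ q, hf.localInverseAt (r q) q = r q := fun q => by
    have := hf.localInverseAt_apply_self (x := r q)
    rwa [hrr] at this
  have hsmooth : ContMDiff I I ∞ f := by
    intro x
    rw [contMDiffAt_iff_target]
    refine ⟨hf.continuous.continuousAt, ?_⟩
    obtain ⟨g, hg, hgx, hev⟩ :=
      hf.localInverse_comp_eventuallyEq hd (r (f x)) x (hsrc (f x))
    rw [hval] at hgx
    have h1 : ContMDiffAt I 𝓘(ℝ, E) ∞ (extChartAt I (r (f x)) ∘ g) x := by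
      refine ContMDiffAt.comp x ?_ (hg x)
      rw [hgx]; exact contMDiffAt_extChartAt
    refine h1.congr_of_eventuallyEq ?_
    filter_upwards [hev] with z hz
    simp [extChartAt, hchart, hz]
  have hinv : ∀ a, ContMDiffOn I I ∞ (hf.localInverseAt a) (hf.localInverseAt a).source := by
    intro a q hq
    refine ContMDiffAt.contMDiffWithinAt ?_
    obtain ⟨g, hg, hgx, hev⟩ :=
      hf.localInverse_comp_eventuallyEq hd a (r q) (by rwa [hrr])
    have hc : ContMDiffAt I I ∞ (chartAt H (r q) ∘ hf.localInverseAt (r q)) q := by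
      exact contMDiffAt_of_mem_maximalAtlas (e := chartAt H q)
        (IsManifold.chart_mem_maximalAtlas q) (mem_chart_source H q)
    have hmem : (chartAt H (r q) ∘ hf.localInverseAt (r q)) q ∈ (chartAt H (r q)).target := by
      simp [hval]
    have hL : ContMDiffAt I I ∞
        ((chartAt H (r q)).symm ∘ (chartAt H (r q) ∘ hf.localInverseAt (r q))) q :=
      ((contMDiffOn_chart_symm (I := I) (x := r q) _ hmem).contMDiffAt
        ((chartAt H (r q)).open_target.mem_nhds hmem)).comp q hc
    have hLq : ((chartAt H (r q)).symm ∘ (chartAt H (r q) ∘ hf.localInverseAt (r q))) q = r q := by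
      simp [hval]
    have hfin := (hg _).comp q hL
    refine hfin.congr_of_eventuallyEq ?_
    have hcont : Filter.Tendsto (hf.localInverseAt (r q)) (𝓝 q) (𝓝 (r q)) := by
      have := (hf.localInverseAt (r q)).continuousAt (hsrc q)
      rwa [ContinuousAt, hval] at this
    filter_upwards [hcont.eventually hev, (hf.localInverseAt (r q)).open_source.mem_nhds (hsrc q),
      hcont.eventually ((chartAt H (r q)).open_source.mem_nhds (mem_chart_source H (r q)))]
      with z hz hz2 hz3
    rw [hf.apply_localInverseAt_of_mem hz2] at hz
    have h4 : (chartAt H (r q)).symm (chartAt H (r q) (hf.localInverseAt (r q) z))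
        = hf.localInverseAt (r q) z := (chartAt H (r q)).left_inv hz3
    simp only [Function.comp, h4, hz]
  intro x
  refine ⟨{ toFun := f
            invFun := hf.localInverseAt x
            source := (hf.localInverseAt x).target
            target := (hf.localInverseAt x).source
            map_source' := fun z hz => ?_
            map_target' := fun z hz => (hf.localInverseAt x).map_source hz
            left_inv' := fun z hz => ?_
            right_inv' := fun z hz => hf.apply_localInverseAt_of_mem hz
            open_source := (hf.localInverseAt x).open_target
            open_target := (hf.localInverseAt x).open_source
            contMDiffOn_toFun := hsmooth.contMDiffOn
            contMDiffOn_invFun := hinv x }, hf.self_mem_localInverseAt_target, fun z _ => rfl⟩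
  · have := (hf.localInverseAt x).map_target hz
    rwa [hf.localInverseAt_symm] at this
  · have := (hf.localInverseAt x).right_inv hz
    rwa [hf.localInverseAt_symm] at this

end QuotientManifold

section MappingTorus

variable {E : Type*} [NormedAddCommGroup E] [NormedSpace ℝ E] {H : Type*} [TopologicalSpace H]
  {I : ModelWithCorners ℝ E H} {S : Type*} [TopologicalSpace S] [ChartedSpace H S]

/-- The manifold `S × ℝ`, on which `ℤ` acts through the deck transformation
`(x, t) ↦ (h x, t - 1)`. -/
def TorusCover (_h : S ≃ₘ⟮I, I⟯ S) : Type _ := S × ℝ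

namespace TorusCover

variable (h : S ≃ₘ⟮I, I⟯ S)

instance : TopologicalSpace (TorusCover h) := inferInstanceAs (TopologicalSpace (S × ℝ))

instance [T2Space S] : T2Space (TorusCover h) := inferInstanceAs (T2Space (S × ℝ))

instance [CompactSpace S] [T2Space S] : LocallyCompactSpace (TorusCover h) :=
  inferInstanceAs (LocallyCompactSpace (S × ℝ))

instance : ChartedSpace (ModelProd H ℝ) (TorusCover h) :=
  inferInstanceAs (ChartedSpace (ModelProd H ℝ) (S × ℝ))

instance [IsManifold I ∞ S] : IsManifold (I.prod 𝓘(ℝ, ℝ)) ∞ (TorusCover h) :=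
  inferInstanceAs (IsManifold (I.prod 𝓘(ℝ, ℝ)) ∞ (S × ℝ))

/-- `n ∈ ℤ` acts on `S × ℝ` by `(x, t) ↦ (h^n x, t - n)`. -/
instance : AddAction ℤ (TorusCover h) where
  vadd n p := ((h.toEquiv ^ n : Equiv.Perm S) p.1, p.2 - (n : ℝ))
  zero_vadd p := by
    change ((h.toEquiv ^ (0 : ℤ) : Equiv.Perm S) p.1, p.2 - ((0 : ℤ) : ℝ)) = p
    rw [zpow_zero, Int.cast_zero, sub_zero]
    rfl
  add_vadd m n p := by
    change ((h.toEquiv ^ (m + n) : Equiv.Perm S) p.1, p.2 - ((m + n : ℤ) : ℝ))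
      = ((h.toEquiv ^ m : Equiv.Perm S) ((h.toEquiv ^ n : Equiv.Perm S) p.1),
          p.2 - (n : ℝ) - (m : ℝ))
    rw [zpow_add]
    refine Prod.ext rfl ?_
    push_cast
    ring

lemma vadd_def (n : ℤ) (p : TorusCover h) :
    n +ᵥ p = (((h.toEquiv ^ n : Equiv.Perm S) p.1, p.2 - (n : ℝ)) : S × ℝ) := rfl

lemma contMDiff_zpow (n : ℤ) : ContMDiff I I ∞ (h.toEquiv ^ n : Equiv.Perm S) := by
  have hnat : ∀ k : ℕ, ContMDiff I I ∞ (h.toEquiv ^ k : Equiv.Perm S) ∧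
      ContMDiff I I ∞ ((h.toEquiv ^ k)⁻¹ : Equiv.Perm S) := by
    intro k
    induction k with
    | zero => exact ⟨contMDiff_id, contMDiff_id⟩
    | succ k ih =>
      constructor
      · rw [pow_succ]; exact ih.1.comp h.contMDiff
      · rw [pow_succ', mul_inv_rev]; exact ih.2.comp h.symm.contMDiff
  cases n with
  | ofNat k => simpa using (hnat k).1
  | negSucc k => simpa using (hnat (k + 1)).2

lemma contMDiff_vadd (n : ℤ) :
    ContMDiff (I.prod 𝓘(ℝ, ℝ)) (I.prod 𝓘(ℝ, ℝ)) ∞ (fun p : TorusCover h => n +ᵥ p) := by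
  have h1 : ContMDiff (I.prod 𝓘(ℝ, ℝ)) (I.prod 𝓘(ℝ, ℝ)) ∞
      (fun p : S × ℝ => ((h.toEquiv ^ n : Equiv.Perm S) p.1, p.2 - (n : ℝ))) :=
    ((contMDiff_zpow h n).comp contMDiff_fst).prodMk
      ((contDiff_id.sub contDiff_const).contMDiff.comp contMDiff_snd)
  exact h1

instance : ContinuousConstVAdd ℤ (TorusCover h) := ⟨fun n => (contMDiff_vadd h n).continuous⟩

instance : IsCancelVAdd ℤ (TorusCover h) where
  left_cancel' n p q hpq := by
    have := congrArg (fun z => -n +ᵥ z) hpq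
    simpa using this
  right_cancel' m n p hmn := by
    have h2 : p.2 - (m : ℝ) = p.2 - (n : ℝ) := congrArg Prod.snd hmn
    exact_mod_cast sub_right_injective h2

instance : ProperlyDiscontinuousVAdd ℤ (TorusCover h) where
  finite_disjoint_inter_image {K L} hK hL := by
    have hsnd : Continuous (fun p : TorusCover h => p.2) := continuous_snd
    obtain ⟨a, ha⟩ := (hK.image hsnd).isBounded.subset_closedBall 0
    obtain ⟨b, hb⟩ := (hL.image hsnd).isBounded.subset_closedBall 0
    refine (Set.finite_Icc (-⌈a + b⌉) ⌈a + b⌉).subset ?_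
    rintro n ⟨_, ⟨p, hp, rfl⟩, hpL⟩
    have h1 : |p.2| ≤ a := by simpa using ha ⟨p, hp, rfl⟩
    have h2 : |p.2 - (n : ℝ)| ≤ b := by
      simpa [TorusCover.vadd_def] using hb ⟨_, hpL, rfl⟩
    have h3 : |(n : ℝ)| ≤ a + b := by
      rw [abs_le] at *
      constructor <;> linarith
    have h4 := abs_le.1 (h3.trans (Int.le_ceil (a + b)))
    exact ⟨by exact_mod_cast h4.1, by exact_mod_cast h4.2⟩

end TorusCover

/-- The mapping torus `Σ(S, h)`, as the quotient of `S × ℝ` by `(x, t) ∼ (h x, t - 1)`. In other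
words, this is the quotient of `S × [0, 1]` by `(x, 1) ∼ (h x, 0)`, see `exists_proj_eq` and
`proj_eq_proj_iff` below. -/
def MappingTorus (h : S ≃ₘ⟮I, I⟯ S) : Type _ := AddAction.orbitRel.Quotient ℤ (TorusCover h)

namespace MappingTorus

variable (h : S ≃ₘ⟮I, I⟯ S)

instance : TopologicalSpace (MappingTorus h) :=
  inferInstanceAs (TopologicalSpace (AddAction.orbitRel.Quotient ℤ (TorusCover h)))

/-- The projection `S × ℝ → Σ(S, h)`. -/
def proj (p : S × ℝ) : MappingTorus h := Quotient.mk (AddAction.orbitRel ℤ (TorusCover h)) p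

lemma proj_surjective : Function.Surjective (proj h) := Quotient.mk_surjective

lemma proj_eq_iff (p q : S × ℝ) : proj h p = proj h q ↔
    ∃ n : ℤ, q = ((h.toEquiv ^ n : Equiv.Perm S) p.1, p.2 - (n : ℝ)) := by
  refine (eq_comm.trans Quotient.eq).trans ?_
  exact exists_congr fun n => eq_comm

lemma proj_one (x : S) : proj h (x, 1) = proj h (h x, 0) :=
  (proj_eq_iff h _ _).2 ⟨1, by simp⟩

lemma hasSmoothDeckMaps_proj :
    HasSmoothDeckMaps (X := TorusCover h) (I.prod 𝓘(ℝ, ℝ)) (proj h) := by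
  intro p q hpq
  obtain ⟨n, hn⟩ := (proj_eq_iff h p q).1 hpq
  refine ⟨fun z => n +ᵥ z, TorusCover.contMDiff_vadd h n, hn.symm, fun z => ?_⟩
  exact ((proj_eq_iff h z _).2 ⟨n, rfl⟩).symm

/-- `S × [0, 1]` maps onto the mapping torus. -/
lemma exists_proj_eq (q : MappingTorus h) :
    ∃ (x : S) (t : ℝ), t ∈ Set.Icc (0 : ℝ) 1 ∧ proj h (x, t) = q := by
  obtain ⟨p, rfl⟩ := proj_surjective h q
  exact ⟨_, _, ⟨Int.fract_nonneg p.2, (Int.fract_lt_one p.2).le⟩,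
    ((proj_eq_iff h p _).2 ⟨⌊p.2⌋, rfl⟩).symm⟩

/-- On `S × [0, 1]` only `(x, 1)` and `(h x, 0)` are identified. -/
lemma proj_eq_proj_iff {x y : S} {s t : ℝ} (hs : s ∈ Set.Icc (0 : ℝ) 1)
    (ht : t ∈ Set.Icc (0 : ℝ) 1) : proj h (x, s) = proj h (y, t) ↔
      (x = y ∧ s = t) ∨ (s = 1 ∧ t = 0 ∧ y = h x) ∨ (s = 0 ∧ t = 1 ∧ x = h y) := by
  constructor
  · intro hst
    obtain ⟨n, hn⟩ := (proj_eq_iff h _ _).1 hst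
    have h1 : y = (h.toEquiv ^ n : Equiv.Perm S) x := congrArg Prod.fst hn
    have h2 : t = s - (n : ℝ) := congrArg Prod.snd hn
    have h3 : n ≤ 1 := by
      have : (n : ℝ) ≤ 1 := by linarith [hs.2, ht.1]
      exact_mod_cast this
    have h4 : -1 ≤ n := by
      have : (-1 : ℝ) ≤ n := by linarith [hs.1, ht.2]
      exact_mod_cast this
    obtain rfl | rfl | rfl : n = -1 ∨ n = 0 ∨ n = 1 := by omega
    · right; right
      push_cast at h2
      refine ⟨by linarith [hs.1, ht.2], by linarith [hs.1, ht.2], ?_⟩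
      rw [h1, zpow_neg_one]
      exact (h.toEquiv.apply_symm_apply x).symm
    · left
      push_cast at h2
      exact ⟨h1.symm, by linarith⟩
    · right; left
      push_cast at h2
      refine ⟨by linarith [hs.2, ht.1], by linarith [hs.2, ht.1], ?_⟩
      rw [h1, zpow_one]
      rfl
  · rintro (⟨rfl, rfl⟩ | ⟨rfl, rfl, rfl⟩ | ⟨rfl, rfl, rfl⟩)
    exacts [rfl, proj_one h x, (proj_one h y).symm]

lemma pullback_zpow {Ω : DiffForm I S 2} (hh : IsSymplectomorphism Ω h) (n : ℤ) :
    DiffForm.pullback (h.toEquiv ^ n : Equiv.Perm S) Ω = Ω := by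
  have hone : DiffForm.pullback ((1 : Equiv.Perm S) : S → S) Ω = Ω := DiffForm.pullback_id Ω
  have hmul : ∀ a b : Equiv.Perm S, ContMDiff I I ∞ a → ContMDiff I I ∞ b →
      DiffForm.pullback ((a * b : Equiv.Perm S) : S → S) Ω
        = DiffForm.pullback b (DiffForm.pullback a Ω) :=
    fun a b ha hb => DiffForm.pullback_comp Ω (ha.mdifferentiable (by simp))
      (hb.mdifferentiable (by simp))
  have h1 := TorusCover.contMDiff_zpow h
  have hinv : DiffForm.pullback ((h.toEquiv⁻¹ : Equiv.Perm S) : S → S) Ω = Ω := by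
    have := hmul h.toEquiv h.toEquiv⁻¹ h.contMDiff h.symm.contMDiff
    rw [mul_inv_cancel, hone] at this
    have h2 : DiffForm.pullback h.toEquiv Ω = Ω := hh
    rw [h2] at this
    exact this.symm
  induction n with
  | zero => exact hone
  | succ n ih =>
    rw [zpow_add_one, hmul _ _ (h1 _) h.contMDiff, ih]
    exact hh
  | pred n ih =>
    rw [zpow_sub_one, hmul _ h.toEquiv⁻¹ (h1 _) h.symm.contMDiff, ih]
    exact hinv

variable [CompactSpace S] [T2Space S]

lemma isLocalHomeomorph_proj : IsLocalHomeomorph (X := TorusCover h) (proj h) :=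
  (isAddQuotientCoveringMap_quotientMk_of_properlyDiscontinuousVAdd (G := ℤ)
    (E := TorusCover h)).isCoveringMap.isLocalHomeomorph

/-- The smooth structure of the mapping torus, for which `proj` is a local diffeomorphism. -/
instance : ChartedSpace (ModelProd H ℝ) (MappingTorus h) :=
  (isLocalHomeomorph_proj h).chartedSpace (proj_surjective h)

instance [IsManifold I ∞ S] : IsManifold (I.prod 𝓘(ℝ, ℝ)) ∞ (MappingTorus h) :=
  (isLocalHomeomorph_proj h).isManifold_chartedSpace (proj_surjective h) (hasSmoothDeckMaps_proj h)

lemma isLocalDiffeomorph_proj [IsManifold I ∞ S] :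
    IsLocalDiffeomorph (I.prod 𝓘(ℝ, ℝ)) (I.prod 𝓘(ℝ, ℝ)) ∞ (proj h) := by
  have := (isLocalHomeomorph_proj h).isLocalDiffeomorph_chartedSpace
    (I := I.prod 𝓘(ℝ, ℝ)) (proj_surjective h) (hasSmoothDeckMaps_proj h)
  exact this

/-- The vector field `∂_t` on `S × ℝ`. -/
def ddt (p : S × ℝ) : TangentSpace (I.prod 𝓘(ℝ, ℝ)) p := ((0, 1) : E × ℝ)

/-- The natural `2`-form `Ω_h` on the mapping torus: at the point `proj h p` it corresponds, under
the differential of the local diffeomorphism `proj h`, to the pullback of `Ω` under `S × ℝ → S`.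
It does not depend on `p` when `h` preserves `Ω`, see `pullback_naturalForm`. -/
def naturalForm (Ω : DiffForm I S 2) : DiffForm (I.prod 𝓘(ℝ, ℝ)) (MappingTorus h) 2 := fun q =>
  let p : S × ℝ := (proj_surjective h q).choose
  (DiffForm.pullback (I := I.prod 𝓘(ℝ, ℝ)) Prod.fst Ω p).compContinuousLinearMap
    (mfderiv (I.prod 𝓘(ℝ, ℝ)) (I.prod 𝓘(ℝ, ℝ)) (proj h) p).inverse

/-- The form `Ω_h` is characterized by the fact that it pulls back to `Ω` on `S × ℝ`. -/
theorem pullback_naturalForm [IsManifold I ∞ S] {Ω : DiffForm I S 2}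
    (hh : IsSymplectomorphism Ω h) :
    DiffForm.pullback (I := I.prod 𝓘(ℝ, ℝ)) (proj h) (naturalForm h Ω)
      = DiffForm.pullback (I := I.prod 𝓘(ℝ, ℝ)) (Prod.fst : S × ℝ → S) Ω := by
  set W : DiffForm (I.prod 𝓘(ℝ, ℝ)) (S × ℝ) 2 :=
    DiffForm.pullback (I := I.prod 𝓘(ℝ, ℝ)) (Prod.fst : S × ℝ → S) Ω with hW
  have hproj : MDifferentiable (I.prod 𝓘(ℝ, ℝ)) (I.prod 𝓘(ℝ, ℝ)) (proj h) :=
    (isLocalDiffeomorph_proj h).contMDiff.mdifferentiable (by simp)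
  have hinvt : ∀ p : S × ℝ,
      (mfderiv (I.prod 𝓘(ℝ, ℝ)) (I.prod 𝓘(ℝ, ℝ)) (proj h) p).IsInvertible := fun p =>
    ⟨(isLocalDiffeomorph_proj h p).mfderivToContinuousLinearEquiv (by simp), rfl⟩
  let g : ℤ → S × ℝ → S × ℝ := fun n p => ((h.toEquiv ^ n : Equiv.Perm S) p.1, p.2 - (n : ℝ))
  have hg : ∀ n, MDifferentiable (I.prod 𝓘(ℝ, ℝ)) (I.prod 𝓘(ℝ, ℝ)) (g n) := fun n =>
    (show ContMDiff (I.prod 𝓘(ℝ, ℝ)) (I.prod 𝓘(ℝ, ℝ)) ∞ (g n) from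
      TorusCover.contMDiff_vadd h n).mdifferentiable (by simp)
  have hgW : ∀ n, DiffForm.pullback (g n) W = W := fun n => by
    have h1 := DiffForm.pullback_comp (I := I.prod 𝓘(ℝ, ℝ)) Ω
      (f := g n) (g := (Prod.fst : S × ℝ → S)) mdifferentiable_fst (hg n)
    have h2 := DiffForm.pullback_comp (I := I.prod 𝓘(ℝ, ℝ)) Ω
      (f := (Prod.fst : S × ℝ → S)) (g := (h.toEquiv ^ n : Equiv.Perm S))
      ((TorusCover.contMDiff_zpow h n).mdifferentiable (by simp)) mdifferentiable_fst
    rw [pullback_zpow h hh n] at h2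
    exact h1.symm.trans h2
  have key : ∀ (q : MappingTorus h) (p' : S × ℝ), proj h p' = q → ∀ p, q = proj h p →
      ((W p').compContinuousLinearMap
        (mfderiv (I.prod 𝓘(ℝ, ℝ)) (I.prod 𝓘(ℝ, ℝ)) (proj h) p').inverse).compContinuousLinearMap
          (mfderiv (I.prod 𝓘(ℝ, ℝ)) (I.prod 𝓘(ℝ, ℝ)) (proj h) p) = W p := by
    rintro _ p' rfl p hp
    obtain ⟨n, hn⟩ := (proj_eq_iff h p' p).1 hp
    obtain rfl : p = g n p' := hn
    have hcomp : mfderiv (I.prod 𝓘(ℝ, ℝ)) (I.prod 𝓘(ℝ, ℝ)) (proj h) p'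
        = (mfderiv (I.prod 𝓘(ℝ, ℝ)) (I.prod 𝓘(ℝ, ℝ)) (proj h) (g n p')).comp
          (mfderiv (I.prod 𝓘(ℝ, ℝ)) (I.prod 𝓘(ℝ, ℝ)) (g n) p') := by
      have := mfderiv_comp p' (hproj (g n p')) (hg n p')
      have hpg : proj h ∘ g n = proj h :=
        funext fun z => ((proj_eq_iff h z _).2 ⟨n, rfl⟩).symm
      rwa [hpg] at this
    have hW' : W p' = (W (g n p')).compContinuousLinearMap
        (mfderiv (I.prod 𝓘(ℝ, ℝ)) (I.prod 𝓘(ℝ, ℝ)) (g n) p') := (congrFun (hgW n) p').symm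
    set A := mfderiv (I.prod 𝓘(ℝ, ℝ)) (I.prod 𝓘(ℝ, ℝ)) (proj h) p'
    set B := mfderiv (I.prod 𝓘(ℝ, ℝ)) (I.prod 𝓘(ℝ, ℝ)) (proj h) (g n p')
    set G := mfderiv (I.prod 𝓘(ℝ, ℝ)) (I.prod 𝓘(ℝ, ℝ)) (g n) p'
    have hfin : ∀ v, G (A.inverse (B v)) = v := fun v => by
      refine (hinvt (g n p')).bijective.1 ?_
      change (B.comp G) (A.inverse (B v)) = B v
      rw [← hcomp]
      exact (hinvt p').self_apply_inverse (B v)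
    rw [hW']
    ext v
    change W (g n p') (fun i => G (A.inverse (B (v i)))) = W (g n p') v
    simp only [hfin]
  funext p
  exact key _ _ (proj_surjective h (proj h p)).choose_spec p rfl

/-- A diffeomorphism `h` of `S` is the first return map of a Reeb vector field `R_α` on the
mapping torus, for a contact form `α` such that `dα` restricts to `Ω` on `S × {0}`, if `R_α` is
everywhere directed by `∂_t` (a multiple of it, necessarily nonzero; its sign is left free). -/
def IsFirstReturnMapOfReeb (Ω : DiffForm I S 2) : Prop :=
  ∃ (α : DiffForm (I.prod 𝓘(ℝ, ℝ)) (MappingTorus h) 1)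
    (R : (q : MappingTorus h) → TangentSpace (I.prod 𝓘(ℝ, ℝ)) q),
    IsContactForm α ∧ IsReebField α R ∧
    DiffForm.pullback (I := I) (fun x : S => proj h (x, 0)) α.extD = Ω ∧
    ∀ p : S × ℝ, ∃ c : ℝ, R (proj h p) =
      c • mfderiv (I.prod 𝓘(ℝ, ℝ)) (I.prod 𝓘(ℝ, ℝ)) (proj h) p (ddt p)

end MappingTorus

end MappingTorus

end

section AlternatingSmooth

variable {V W G : Type*} [NormedAddCommGroup V] [NormedSpace ℝ V] [NormedAddCommGroup W]
  [NormedSpace ℝ W] [NormedAddCommGroup G] [NormedSpace ℝ G]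

/-- Alternatization as a continuous linear map. -/
noncomputable def alternatizationCLM (V G : Type*) [NormedAddCommGroup V] [NormedSpace ℝ V]
    [NormedAddCommGroup G] [NormedSpace ℝ G] (k : ℕ) :
    ContinuousMultilinearMap ℝ (fun _ : Fin k => V) G →L[ℝ] V [⋀^Fin k]→L[ℝ] G :=
  LinearMap.mkContinuous
    { toFun := ContinuousMultilinearMap.alternatization
      map_add' := map_add _
      map_smul' := fun c m => by
        ext v
        simp [ContinuousMultilinearMap.alternatization_apply_apply, Finset.smul_sum,
          smul_comm c] }
    (Fintype.card (Equiv.Perm (Fin k))) fun m => by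
      refine ContinuousAlternatingMap.opNorm_le_bound _ (by positivity) fun v => ?_
      simp only [LinearMap.coe_mk, AddHom.coe_mk,
        ContinuousMultilinearMap.alternatization_apply_apply]
      refine (norm_sum_le _ _).trans ?_
      rw [mul_assoc, ← nsmul_eq_mul]
      refine Finset.sum_le_card_nsmul _ _ _ fun τ _ => ?_
      have h1 : ‖Equiv.Perm.sign τ • m (v ∘ τ)‖ = ‖m (v ∘ τ)‖ := by
        rcases Int.units_eq_one_or (Equiv.Perm.sign τ) with h | h <;> simp [h]
      rw [h1, ← Equiv.prod_comp τ]
      exact m.le_opNorm _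

lemma alternatizationCLM_toContinuousMultilinearMap {k : ℕ} (f : V [⋀^Fin k]→L[ℝ] G) :
    alternatizationCLM V G k f.toContinuousMultilinearMap = (k.factorial : ℝ) • f := by
  ext v
  change ContinuousMultilinearMap.alternatization f.toContinuousMultilinearMap v = _
  rw [ContinuousMultilinearMap.alternatization_apply_apply]
  have h : ∀ τ : Equiv.Perm (Fin k),
      Equiv.Perm.sign τ • f.toContinuousMultilinearMap (v ∘ τ) = f v := fun τ => by
    have := f.toAlternatingMap.map_perm v τ
    change Equiv.Perm.sign τ • f.toAlternatingMap (v ∘ τ) = f v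
    rw [this, smul_smul, Int.units_mul_self, one_smul]
    rfl
  rw [Finset.sum_congr rfl fun τ _ => h τ]
  simp [Fintype.card_perm, Nat.cast_smul_eq_nsmul]

/-- Precomposition of a family of alternating maps with a family of linear maps is smooth. -/
lemma ContDiffOn.continuousAlternatingMap_comp {X : Type*} [NormedAddCommGroup X]
    [NormedSpace ℝ X] {n : WithTop ℕ∞} {k : ℕ} {s : Set X} {f : X → W [⋀^Fin k]→L[ℝ] G}
    {g : X → V →L[ℝ] W} (hf : ContDiffOn ℝ n f s) (hg : ContDiffOn ℝ n g s) :
    ContDiffOn ℝ n (fun x => (f x).compContinuousLinearMap (g x)) s := by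
  have h1 : ContDiffOn ℝ n (fun x =>
      ContinuousMultilinearMap.compContinuousLinearMapContinuousMultilinear ℝ
        (fun _ : Fin k => V) (fun _ => W) G (fun _ => g x)) s :=
    (ContinuousMultilinearMap.contDiff _).comp_contDiffOn (contDiffOn_pi.2 fun _ => hg)
  have h2 : ContDiffOn ℝ n (fun x => (f x).toContinuousMultilinearMap) s :=
    (ContinuousAlternatingMap.toContinuousMultilinearMapCLM (𝕜 := ℝ) (E := W) (F := G) (ι := Fin k)
      ℝ).contDiff.comp_contDiffOn hf
  have h3 := ((alternatizationCLM V G k).contDiff.comp_contDiffOn (h1.clm_apply h2)).const_smul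
    ((k.factorial : ℝ)⁻¹)
  refine h3.congr fun x _ => ?_
  change _ = (k.factorial : ℝ)⁻¹ • alternatizationCLM V G k
    ((f x).compContinuousLinearMap (g x)).toContinuousMultilinearMap
  rw [alternatizationCLM_toContinuousMultilinearMap, inv_smul_smul₀ (by positivity)]

end AlternatingSmooth

namespace DiffForm

variable {E : Type*} [NormedAddCommGroup E] [NormedSpace ℝ E] {H : Type*} [TopologicalSpace H]
  {I : ModelWithCorners ℝ E H} {M : Type*} [TopologicalSpace M] [ChartedSpace H M]
  {F : Type*} [NormedAddCommGroup F] [NormedSpace ℝ F]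

/-- The pullback of a form under a map that is defined on a subset of a vector space. -/
noncomputable def pullbackWithin {k : ℕ} (g : F → M) (s : Set F) (Ω : DiffForm I M k) (x : F) :
    F [⋀^Fin k]→L[ℝ] ℝ :=
  (Ω (g x)).compContinuousLinearMap (mfderivWithin 𝓘(ℝ, F) I g s x)

lemma apply_congr_point {k : ℕ} (Ω : DiffForm I M k) {y z : M} (h : y = z) (v : Fin k → E) :
    Ω y v = Ω z v := by
  subst h; rfl

lemma extChartAt_mem_range (x y : M) : extChartAt I x y ∈ Set.range I := ⟨_, rfl⟩

lemma eventually_mem_extChartAt_source {F : Type*} [TopologicalSpace F] {g : F → M} {s : Set F}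
    {x₀ : F}
    (hg : ContinuousWithinAt g s x₀) :
    ∀ᶠ x in 𝓝[s] x₀, g x ∈ (extChartAt I (g x₀)).source :=
  hg.eventually ((isOpen_extChartAt_source (g x₀)).mem_nhds (mem_extChartAt_source (g x₀)))

/-- The pullback of a form in terms of its expression in a chart. -/
lemma pullbackWithin_eventuallyEq [IsManifold I ∞ M] {k : ℕ} (Ω : DiffForm I M k) {g : F → M}
    {s : Set F} (hs : UniqueDiffOn ℝ s) (hg : ContMDiffOn 𝓘(ℝ, F) I ∞ g s) {x₀ : F}
    (hx₀ : x₀ ∈ s) :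
    pullbackWithin g s Ω =ᶠ[𝓝[s] x₀] fun x =>
      (Ω.inChart (g x₀) (extChartAt I (g x₀) (g x))).compContinuousLinearMap
        (fderivWithin ℝ (extChartAt I (g x₀) ∘ g) s x) := by
  have h1 := eventually_mem_extChartAt_source (I := I) (hg x₀ hx₀).continuousWithinAt
  filter_upwards [h1, eventually_eventually_nhdsWithin.2 h1, self_mem_nhdsWithin] with x hx hxe hxs
  set φ := extChartAt I (g x₀)
  have hφ : MDifferentiableAt I 𝓘(ℝ, E) φ (g x) :=
    (contMDiffAt_extChartAt' (n := ∞) (by simpa [φ] using hx)).mdifferentiableAt (by simp)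
  have hgx : MDifferentiableWithinAt 𝓘(ℝ, F) I g s x :=
    (hg x hxs).mdifferentiableWithinAt (by simp)
  have hG : MDifferentiableWithinAt 𝓘(ℝ, F) 𝓘(ℝ, E) (φ ∘ g) s x :=
    hφ.comp_mdifferentiableWithinAt x hgx
  have hsymm : MDifferentiableWithinAt 𝓘(ℝ, E) I φ.symm (Set.range I) ((φ ∘ g) x) :=
    (contMDiffWithinAt_extChartAt_symm_range (n := ∞) (g x₀)
      (φ.map_source hx)).mdifferentiableWithinAt (by simp)
  have hcomp := mfderivWithin_comp x hsymm hG
    (fun z _ => extChartAt_mem_range (I := I) (g x₀) (g z)) (hs x hxs).uniqueMDiffWithinAt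
  have hcongr : mfderivWithin 𝓘(ℝ, F) I (φ.symm ∘ (φ ∘ g)) s x = mfderivWithin 𝓘(ℝ, F) I g s x := by
    have he : φ.symm ∘ (φ ∘ g) =ᶠ[𝓝[s] x] g := by
      filter_upwards [hxe] with z hz using φ.left_inv hz
    have := he.mfderivWithin_eq_of_mem (I := 𝓘(ℝ, F)) (I' := I) hxs
    exact this
  rw [mfderivWithin_eq_fderivWithin] at hcomp
  ext v
  have h2 : ∀ w : F, (mfderivWithin 𝓘(ℝ, F) I g s x w : E) =
      mfderivWithin 𝓘(ℝ, E) I φ.symm (Set.range I) (φ (g x)) (fderivWithin ℝ (φ ∘ g) s x w) :=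
    fun w => by
      have := DFunLike.congr_fun (hcongr.symm.trans hcomp) w
      exact this
  change Ω (g x) (fun i => mfderivWithin 𝓘(ℝ, F) I g s x (v i)) =
    Ω (φ.symm (φ (g x))) (fun i => mfderivWithin 𝓘(ℝ, E) I φ.symm (Set.range I) (φ (g x))
      (fderivWithin ℝ (φ ∘ g) s x (v i)))
  refine (apply_congr_point Ω (φ.left_inv hx).symm _).trans ?_
  exact congrArg (Ω (φ.symm (φ (g x)))) (funext fun i => h2 (v i))

lemma contDiffWithinAt_extChartAt_comp [IsManifold I ∞ M] {g : F → M} {s : Set F}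
    (hg : ContMDiffOn 𝓘(ℝ, F) I ∞ g s) {x₀ : F} (hx₀ : x₀ ∈ s) :
    ContDiffWithinAt ℝ ∞ (extChartAt I (g x₀) ∘ g) s x₀ := by
  rw [← contMDiffWithinAt_iff_contDiffWithinAt]
  exact (contMDiffAt_extChartAt (n := ∞)).comp_contMDiffWithinAt x₀ (hg x₀ hx₀)

/-- The pullback of a smooth form under a smooth map is smooth. -/
lemma Smooth.contDiffOn_pullbackWithin [IsManifold I ∞ M] {k : ℕ} {Ω : DiffForm I M k}
    (hΩ : Ω.Smooth) {g : F → M} {s : Set F} (hs : UniqueDiffOn ℝ s)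
    (hg : ContMDiffOn 𝓘(ℝ, F) I ∞ g s) : ContDiffOn ℝ ∞ (pullbackWithin g s Ω) s := by
  intro x₀ hx₀
  set φ := extChartAt I (g x₀) with hφ
  obtain ⟨u, hu, hxu, hus⟩ : ∃ u, IsOpen u ∧ x₀ ∈ u ∧ u ∩ s ⊆ g ⁻¹' φ.source := by
    have h1 := eventually_mem_extChartAt_source (I := I) (hg x₀ hx₀).continuousWithinAt
    exact mem_nhdsWithin.1 h1
  have hG : ContDiffOn ℝ ∞ (φ ∘ g) (s ∩ u) := by
    rw [← contMDiffOn_iff_contDiffOn]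
    exact (contMDiffOn_extChartAt (n := ∞)).comp (hg.mono Set.inter_subset_left)
      (fun z hz => by simpa [hφ] using hus ⟨hz.2, hz.1⟩)
  have hin : ContDiffOn ℝ ∞ (fun x => Ω.inChart (g x₀) (φ (g x))) (s ∩ u) :=
    (hΩ (g x₀)).comp hG (fun z hz => φ.map_source (hus ⟨hz.2, hz.1⟩))
  have hd : ContDiffOn ℝ ∞ (fun x => fderivWithin ℝ (φ ∘ g) s x) (s ∩ u) := by
    refine (hG.fderivWithin (hs.inter hu) (m := ∞) (by simp)).congr fun x hx => ?_
    exact (fderivWithin_inter (hu.mem_nhds hx.2)).symm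
  have hfin := (hin.continuousAlternatingMap_comp hd) x₀ ⟨hx₀, hxu⟩
  refine ContDiffWithinAt.congr_of_eventuallyEq ?_ (pullbackWithin_eventuallyEq Ω hs hg hx₀)
    ((pullbackWithin_eventuallyEq Ω hs hg hx₀).eq_of_nhdsWithin hx₀)
  exact (contDiffWithinAt_inter (hu.mem_nhds hxu)).1 hfin

/-- The exterior derivative commutes with pullbacks. -/
lemma Smooth.extDerivWithin_pullbackWithin [IsManifold I ∞ M] {k : ℕ} {Ω : DiffForm I M k}
    (hΩ : Ω.Smooth) {g : F → M} {s : Set F} (hs : UniqueDiffOn ℝ s)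
    (hg : ContMDiffOn 𝓘(ℝ, F) I ∞ g s) {x : F} (hx : x ∈ s) (hxc : x ∈ closure (interior s)) :
    extDerivWithin (pullbackWithin g s Ω) s x = pullbackWithin g s Ω.extD x := by
  set φ := extChartAt I (g x) with hφ
  rw [(pullbackWithin_eventuallyEq Ω hs hg hx).extDerivWithin_eq_of_mem hx]
  have h1 := extDerivWithin_pullback (f := φ ∘ g) (t := Set.range I) (s := s)
    (r := ∞) (x := x) (hΩ.differentiableWithinAt (g x)) (contDiffWithinAt_extChartAt_comp hg hx)
    (by simpa using WithTop.coe_le_coe.2 (le_top : (2 : ℕ∞) ≤ ⊤)) hs hxc hx (fun z _ => extChartAt_mem_range (I := I) (g x) (g z))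
  refine h1.trans ?_
  have hcomp := mfderiv_comp_mfderivWithin x
    ((contMDiffAt_extChartAt (I := I) (n := ∞) (x := g x)).mdifferentiableAt (by simp))
    ((hg x hx).mdifferentiableWithinAt (by simp)) (hs x hx).uniqueMDiffWithinAt
  rw [mfderivWithin_eq_fderivWithin] at hcomp
  ext v
  have h2 : ∀ w : F, fderivWithin ℝ (φ ∘ g) s x w =
      mfderiv I 𝓘(ℝ, E) φ (g x) (mfderivWithin 𝓘(ℝ, F) I g s x w) :=
    fun w => by
      have := DFunLike.congr_fun hcomp w
      exact this
  change extDerivWithin (Ω.inChart (g x)) (Set.range I) (φ (g x))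
    (fun i => fderivWithin ℝ (φ ∘ g) s x (v i)) = extDerivWithin (Ω.inChart (g x)) (Set.range I)
      (φ (g x)) (fun i => mfderiv I 𝓘(ℝ, E) φ (g x) (mfderivWithin 𝓘(ℝ, F) I g s x (v i)))
  exact congrArg _ (funext fun i => h2 (v i))

end DiffForm

namespace DiffForm

variable {E : Type*} [NormedAddCommGroup E] [NormedSpace ℝ E] {H : Type*} [TopologicalSpace H]
  {I : ModelWithCorners ℝ E H} {M : Type*} [TopologicalSpace M] [ChartedSpace H M]
  {E' : Type*} [NormedAddCommGroup E'] [NormedSpace ℝ E'] {H' : Type*} [TopologicalSpace H']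
  {J : ModelWithCorners ℝ E' H'} {N : Type*} [TopologicalSpace N] [ChartedSpace H' N]
  {F : Type*} [NormedAddCommGroup F] [NormedSpace ℝ F] {k : ℕ}

lemma pullbackWithin_congr (Ω : DiffForm I M k) {g g' : F → M} {s : Set F} (h : Set.EqOn g g' s)
    {x : F} (hx : x ∈ s) : pullbackWithin g s Ω x = pullbackWithin g' s Ω x := by
  have h1 : ∀ w : F, (mfderivWithin 𝓘(ℝ, F) I g s x w : E) = mfderivWithin 𝓘(ℝ, F) I g' s x w :=
    fun w => by
      have := mfderivWithin_congr_of_mem (I := 𝓘(ℝ, F)) (I' := I) h hx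
      exact DFunLike.congr_fun this w
  ext v
  refine (apply_congr_point Ω (h hx) _).trans ?_
  exact congrArg (Ω (g' x)) (funext fun i => h1 (v i))

lemma pullbackWithin_congr_set (Ω : DiffForm I M k) (g : F → M) {s t : Set F} {x : F}
    (h : s =ᶠ[𝓝 x] t) : pullbackWithin g s Ω x = pullbackWithin g t Ω x := by
  rw [pullbackWithin, pullbackWithin, mfderivWithin_congr_set h]

/-- Functoriality of the pullback. -/
lemma pullbackWithin_pullback (Ω : DiffForm J N k) {f : M → N} {g : F → M} {s : Set F} {x : F}
    (hf : MDifferentiableAt I J f (g x)) (hg : MDifferentiableWithinAt 𝓘(ℝ, F) I g s x)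
    (hs : UniqueDiffWithinAt ℝ s x) :
    pullbackWithin g s (pullback (I := I) f Ω) x = pullbackWithin (f ∘ g) s Ω x := by
  have h1 : ∀ w : F, (mfderivWithin 𝓘(ℝ, F) J (f ∘ g) s x w : E') =
      mfderiv I J f (g x) (mfderivWithin 𝓘(ℝ, F) I g s x w) := fun w => by
    have := mfderiv_comp_mfderivWithin x hf hg hs.uniqueMDiffWithinAt
    exact DFunLike.congr_fun this w
  ext v
  exact congrArg (Ω (f (g x))) (funext fun i => (h1 (v i)).symm)

lemma extChartAt_target_eventuallyEq_range (x₀ : M) {y : E} (hy : y ∈ (extChartAt I x₀).target) :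
    (Set.range I : Set E) =ᶠ[𝓝 y] (extChartAt I x₀).target := by
  filter_upwards [mem_nhdsWithin_iff_eventually.1 (extChartAt_target_mem_nhdsWithin_of_mem hy)]
    with z hz
  exact propext ⟨hz, fun h => extChartAt_target_subset_range x₀ h⟩

lemma inChart_eq_pullbackWithin (Ω : DiffForm I M k) (x₀ : M) {y : E}
    (hy : y ∈ (extChartAt I x₀).target) :
    Ω.inChart x₀ y = pullbackWithin (extChartAt I x₀).symm (extChartAt I x₀).target Ω y :=
  pullbackWithin_congr_set Ω _ (extChartAt_target_eventuallyEq_range x₀ hy)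

lemma inChart_comp_mfderiv_extChartAt [IsManifold I ∞ M] (Ω : DiffForm I M k) (x : M) :
    (Ω.inChart x (extChartAt I x x)).compContinuousLinearMap
      (mfderiv I 𝓘(ℝ, E) (extChartAt I x) x) = Ω x := by
  have : IsManifold I 1 M := IsManifold.of_le (n := ∞) (by simp)
  have hx := extChartAt_to_inv (I := I) x
  have h1 : ∀ w : E, (mfderivWithin 𝓘(ℝ, E) I (extChartAt I x).symm (Set.range I)
      (extChartAt I x x) (mfderiv I 𝓘(ℝ, E) (extChartAt I x) x w) : E) = w := fun w => by
    have := mfderivWithin_extChartAt_symm_comp_mfderiv_extChartAt (I := I)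
      (mem_extChartAt_target (I := I) x)
    rw [hx] at this
    exact DFunLike.congr_fun this w
  ext v
  refine (apply_congr_point Ω hx _).trans ?_
  exact congrArg (Ω x) (funext fun i => h1 (v i))

lemma contMDiffOn_comp_extChartAt_symm [IsManifold I ∞ M] {f : M → N} (hf : ContMDiff I J ∞ f)
    (x₀ : M) : ContMDiffOn 𝓘(ℝ, E) J ∞ (f ∘ (extChartAt I x₀).symm) (extChartAt I x₀).target :=
  hf.comp_contMDiffOn (contMDiffOn_extChartAt_symm x₀)

lemma inChart_pullback [IsManifold I ∞ M] (Ω : DiffForm J N k) {f : M → N}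
    (hf : ContMDiff I J ∞ f) (x₀ : M) {y : E} (hy : y ∈ (extChartAt I x₀).target) :
    (pullback (I := I) f Ω).inChart x₀ y =
      pullbackWithin (f ∘ (extChartAt I x₀).symm) (extChartAt I x₀).target Ω y := by
  rw [inChart_eq_pullbackWithin _ _ hy]
  exact pullbackWithin_pullback Ω (hf.mdifferentiable (by simp) _)
    ((contMDiffOn_extChartAt_symm (n := ∞) x₀ y hy).mdifferentiableWithinAt (by simp))
    (uniqueDiffOn_extChartAt_target x₀ y hy)

/-- The pullback of a smooth form under a smooth map is smooth. -/
lemma Smooth.pullback [IsManifold I ∞ M] [IsManifold J ∞ N] {Ω : DiffForm J N k} (hΩ : Ω.Smooth)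
    {f : M → N} (hf : ContMDiff I J ∞ f) : (DiffForm.pullback (I := I) f Ω).Smooth := fun x₀ =>
  (hΩ.contDiffOn_pullbackWithin (uniqueDiffOn_extChartAt_target x₀)
    (contMDiffOn_comp_extChartAt_symm hf x₀)).congr fun _ hy => inChart_pullback Ω hf x₀ hy

/-- The exterior derivative commutes with pullbacks under smooth maps. -/
lemma Smooth.extD_pullback [IsManifold I ∞ M] [IsManifold J ∞ N] {Ω : DiffForm J N k}
    (hΩ : Ω.Smooth) {f : M → N} (hf : ContMDiff I J ∞ f) :
    (DiffForm.pullback (I := I) f Ω).extD = DiffForm.pullback f Ω.extD := by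
  funext x
  have hx := mem_extChartAt_target (I := I) x
  have h1 : extDerivWithin ((DiffForm.pullback (I := I) f Ω).inChart x) (Set.range I)
      (extChartAt I x x) = (DiffForm.pullback (I := I) f Ω.extD).inChart x (extChartAt I x x) := by
    rw [inChart_pullback _ hf x hx, ← hΩ.extDerivWithin_pullbackWithin
      (uniqueDiffOn_extChartAt_target x) (contMDiffOn_comp_extChartAt_symm hf x) hx
      (extChartAt_target_subset_closure_interior hx),
      ← extDerivWithin_congr' (fun y hy => inChart_pullback Ω hf x hy) hx, extDerivWithin,
      fderivWithin_congr_set (extChartAt_target_eventuallyEq_range x hx)]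
    rfl
  rw [extD, h1, inChart_comp_mfderiv_extChartAt]

/-- A form is smooth if its pullback under a surjective local diffeomorphism is smooth. -/
lemma smooth_of_smooth_pullback [IsManifold I ∞ M] [IsManifold J ∞ N] {Θ : DiffForm J N k}
    {f : M → N} (hf : IsLocalDiffeomorph I J ∞ f) (hsurj : Function.Surjective f)
    (hΘ : (DiffForm.pullback (I := I) f Θ).Smooth) : Θ.Smooth := by
  intro q y₀ hy₀
  set φ := extChartAt J q
  obtain ⟨a, ha⟩ := hsurj (φ.symm y₀)
  set L := (hf a).localInverse
  obtain ⟨u, hu, hyu, hus⟩ : ∃ u, IsOpen u ∧ y₀ ∈ u ∧ u ∩ φ.target ⊆ φ.symm ⁻¹' L.source := by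
    refine mem_nhdsWithin.1 ((continuousOn_extChartAt_symm q y₀ hy₀).eventually
      (L.open_source.mem_nhds ?_))
    rw [← ha]
    exact (hf a).localInverse_mem_source
  have hmaps : Set.MapsTo φ.symm (φ.target ∩ u) L.source := fun y hy => hus ⟨hy.2, hy.1⟩
  have hg : ContMDiffOn 𝓘(ℝ, E') I ∞ (L ∘ φ.symm) (φ.target ∩ u) :=
    (hf a).localInverse_contMDiffOn.comp
      ((contMDiffOn_extChartAt_symm q).mono Set.inter_subset_left) hmaps
  have hs : UniqueDiffOn ℝ (φ.target ∩ u) := (uniqueDiffOn_extChartAt_target q).inter hu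
  have hfL : Set.EqOn (f ∘ L ∘ φ.symm) φ.symm (φ.target ∩ u) :=
    fun z hz => (hf a).localInverse_right_inv (hmaps hz)
  have h1 := (hΘ.contDiffOn_pullbackWithin hs hg).congr (f₁ := Θ.inChart q) fun y hy => by
    rw [pullbackWithin_pullback Θ (hf.mdifferentiable (by simp) _)
      ((hg y hy).mdifferentiableWithinAt (by simp)) (hs y hy),
      pullbackWithin_congr Θ hfL hy, inChart_eq_pullbackWithin Θ q hy.1]
    refine pullbackWithin_congr_set Θ _ ?_
    filter_upwards [hu.mem_nhds hy.2] with z hz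
    exact propext ⟨fun h => ⟨h, hz⟩, fun h => h.1⟩
  exact (contDiffWithinAt_inter (hu.mem_nhds hyu)).1 (h1 y₀ ⟨hy₀, hyu⟩)

/-- The pullback under a surjective local diffeomorphism is injective. -/
lemma eq_zero_of_pullback_eq_zero {Θ : DiffForm J N k} {f : M → N}
    (hf : IsLocalDiffeomorph I J ∞ f) (hsurj : Function.Surjective f)
    (hΘ : DiffForm.pullback (I := I) f Θ = 0) : Θ = 0 := by
  funext q
  obtain ⟨p, rfl⟩ := hsurj q
  have hinj : (mfderiv I J f p).IsInvertible :=
    ⟨(hf p).mfderivToContinuousLinearEquiv (by simp), rfl⟩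
  ext v
  choose w hw using fun i => hinj.bijective.2 (v i)
  have h1 : Θ (f p) (fun i => mfderiv I J f p (w i)) = 0 :=
    DFunLike.congr_fun (congrFun hΘ p) w
  rw [show v = fun i => mfderiv I J f p (w i) from funext fun i => (hw i).symm]
  exact h1

end DiffForm

namespace MappingTorus

variable {E : Type*} [NormedAddCommGroup E] [NormedSpace ℝ E] {H : Type*} [TopologicalSpace H]
  {I : ModelWithCorners ℝ E H} {S : Type*} [TopologicalSpace S] [ChartedSpace H S]
  [IsManifold I ∞ S] [CompactSpace S] [T2Space S]

/-- The form `Ω_h` is smooth and closed. -/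
theorem naturalForm_mem_closedForms {Ω : DiffForm I S 2} (hΩ : Ω ∈ closedForms I S 2)
    (h : S ≃ₘ⟮I, I⟯ S) (hh : IsSymplectomorphism Ω h) :
    naturalForm h Ω ∈ closedForms (I.prod 𝓘(ℝ, ℝ)) (MappingTorus h) 2 := by
  have hfst : ContMDiff (I.prod 𝓘(ℝ, ℝ)) I ∞ (Prod.fst : S × ℝ → S) := contMDiff_fst
  have hdiff := isLocalDiffeomorph_proj h
  have hpull := pullback_naturalForm h hh
  have hsmooth : (naturalForm h Ω).Smooth := by
    refine DiffForm.smooth_of_smooth_pullback hdiff (proj_surjective h) ?_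
    rw [hpull]
    exact hΩ.1.pullback hfst
  refine ⟨hsmooth, DiffForm.eq_zero_of_pullback_eq_zero hdiff (proj_surjective h) ?_⟩
  rw [← hsmooth.extD_pullback hdiff.contMDiff, hpull, hΩ.1.extD_pullback hfst, hΩ.2]
  rfl

end MappingTorus

section Calculus

open MeasureTheory

lemma convex_stdSimp (k : ℕ) : Convex ℝ (stdSimp k) := by
  intro x hx y hy a b ha hb hab
  refine ⟨fun i => ?_, ?_⟩
  · simpa using add_nonneg (mul_nonneg ha (hx.1 i)) (mul_nonneg hb (hy.1 i))
  · have h1 := mul_le_mul_of_nonneg_left hx.2 ha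
    have h2 := mul_le_mul_of_nonneg_left hy.2 hb
    simp only [Pi.add_apply, Pi.smul_apply, smul_eq_mul, Finset.sum_add_distrib, ← Finset.mul_sum]
    linarith

lemma stdSimp_mem_nhds {k : ℕ} {x : Fin k → ℝ} (h0 : ∀ i, 0 < x i) (h1 : ∑ i, x i < 1) :
    stdSimp k ∈ 𝓝 x := by
  have ha : ∀ᶠ y : Fin k → ℝ in 𝓝 x, ∀ i, 0 < y i :=
    Filter.eventually_all.2 fun i => (continuous_apply i).continuousAt.eventually (lt_mem_nhds (h0 i))
  have hc : Continuous fun y : Fin k → ℝ => ∑ i, y i := by fun_prop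
  filter_upwards [ha, hc.continuousAt.eventually (gt_mem_nhds h1)] with y hy hy'
  exact ⟨fun i => (hy i).le, hy'.le⟩

lemma subset_closure_interior_stdSimp (k : ℕ) : stdSimp k ⊆ closure (interior (stdSimp k)) := by
  have hne : (interior (stdSimp k)).Nonempty := by
    refine ⟨fun _ => 1 / ((k : ℝ) + 1), mem_interior_iff_mem_nhds.2
      (stdSimp_mem_nhds (fun i => by positivity) ?_)⟩
    simp only [Finset.sum_const, Finset.card_univ, Fintype.card_fin, nsmul_eq_mul]
    rw [mul_one_div, div_lt_one (by positivity)]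
    linarith
  rw [(convex_stdSimp k).closure_interior_eq_closure_of_nonempty_interior hne]
  exact subset_closure

lemma isCompact_stdSimp (k : ℕ) : IsCompact (stdSimp k) := by
  have hcl : IsClosed (stdSimp k) := by
    simp only [stdSimp, Set.ofPred_and, Set.ofPred_forall]
    exact (isClosed_iInter fun i => isClosed_le continuous_const (continuous_apply i)).inter
      (isClosed_le (by fun_prop) continuous_const)
  refine (isCompact_Icc (a := (0 : Fin k → ℝ)) (b := 1)).of_isClosed_subset hcl fun x hx => ?_
  exact ⟨hx.1, fun i => (Finset.single_le_sum (fun j _ => hx.1 j) (Finset.mem_univ i)).trans hx.2⟩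

/-- An integral over the standard `1`-simplex is an integral over the unit interval. -/
lemma setIntegral_stdSimp_one (G : (Fin 1 → ℝ) → ℝ) :
    ∫ x in stdSimp 1, G x = ∫ t in (0 : ℝ)..1, G fun _ => t := by
  have h := ((volume_preserving_funUnique (Fin 1) ℝ).symm _).setIntegral_preimage_emb
    (MeasurableEquiv.measurableEmbedding _) G (stdSimp 1)
  have hset : (MeasurableEquiv.funUnique (Fin 1) ℝ).symm ⁻¹' stdSimp 1 = Set.Icc 0 1 := by
    ext t
    simp [stdSimp]
  rw [intervalIntegral.integral_of_le zero_le_one, ← integral_Icc_eq_integral_Ioc, ← hset]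
  exact h.symm

/-- Integrating a partial derivative over a triangle. -/
lemma integral_triangle {Q Q' : ℝ → ℝ → ℝ}
    (hQ : ContinuousOn (fun p : ℝ × ℝ => Q p.1 p.2) {p | 0 ≤ p.1 ∧ 0 ≤ p.2 ∧ p.1 + p.2 ≤ 1})
    (hQ' : ContinuousOn (fun p : ℝ × ℝ => Q' p.1 p.2) {p | 0 ≤ p.1 ∧ 0 ≤ p.2 ∧ p.1 + p.2 ≤ 1})
    (hd : ∀ x y, 0 < x → 0 < y → x + y < 1 → HasDerivAt (fun x => Q x y) (Q' x y) x) :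
    ∫ p in {p : ℝ × ℝ | 0 ≤ p.1 ∧ 0 ≤ p.2 ∧ p.1 + p.2 ≤ 1}, Q' p.1 p.2 =
      ∫ y in (0 : ℝ)..1, Q (1 - y) y - Q 0 y := by
  set T := {p : ℝ × ℝ | 0 ≤ p.1 ∧ 0 ≤ p.2 ∧ p.1 + p.2 ≤ 1} with hT
  have hcl : IsClosed T := (isClosed_le continuous_const continuous_fst).inter
    ((isClosed_le continuous_const continuous_snd).inter
      (isClosed_le (continuous_fst.add continuous_snd) continuous_const))
  have hcpt : IsCompact T := by
    refine (isCompact_Icc (a := ((0, 0) : ℝ × ℝ)) (b := (1, 1))).of_isClosed_subset hcl ?_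
    rintro ⟨x, y⟩ ⟨h1, h2, h3⟩
    simp only at h1 h2 h3
    exact ⟨⟨h1, h2⟩, ⟨by simp only; linarith, by simp only; linarith⟩⟩
  have hint : Integrable (T.indicator fun p : ℝ × ℝ => Q' p.1 p.2) :=
    (integrable_indicator_iff hcl.measurableSet).2 (hQ'.integrableOn_compact hcpt)
  rw [← integral_indicator hcl.measurableSet, Measure.volume_eq_prod, integral_prod_symm _ hint,
    intervalIntegral.integral_of_le zero_le_one, ← integral_Icc_eq_integral_Ioc,
    ← integral_indicator measurableSet_Icc]
  refine integral_congr_ae ?_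
  filter_upwards [compl_mem_ae_iff.2 (measure_singleton (0 : ℝ))] with y hy0
  by_cases hy : y ∈ Set.Icc (0 : ℝ) 1
  · have hmaps : ∀ x ∈ Set.Icc 0 (1 - y), (x, y) ∈ T := fun x hx =>
      ⟨hx.1, hy.1, by simp only; linarith [hx.2]⟩
    have hcurve : Continuous fun x : ℝ => (x, y) := by fun_prop
    have h1 : (fun x => T.indicator (fun p : ℝ × ℝ => Q' p.1 p.2) (x, y)) =
        (Set.Icc 0 (1 - y)).indicator fun x => Q' x y := by
      funext x
      by_cases hx : x ∈ Set.Icc 0 (1 - y)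
      · rw [Set.indicator_of_mem hx, Set.indicator_of_mem (hmaps x hx)]
      · rw [Set.indicator_of_notMem hx, Set.indicator_of_notMem]
        exact fun h => hx ⟨h.1, by have := h.2.2; simp only at this; linarith⟩
    have h01 : 0 ≤ 1 - y := by linarith [hy.2]
    simp only [h1, Set.indicator_of_mem hy]
    rw [integral_indicator measurableSet_Icc, integral_Icc_eq_integral_Ioc,
      ← intervalIntegral.integral_of_le h01]
    have hc1 : ContinuousOn (fun x => Q x y) (Set.Icc 0 (1 - y)) :=
      hQ.comp hcurve.continuousOn hmaps
    have hc2 : ContinuousOn (fun x => Q' x y) (Set.Icc 0 (1 - y)) :=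
      hQ'.comp hcurve.continuousOn hmaps
    exact intervalIntegral.integral_eq_sub_of_hasDerivAt_of_le h01 hc1
      (fun x hx => hd x y hx.1 (hy.1.lt_of_ne (Ne.symm hy0)) (by linarith [hx.2]))
      ((hc2.mono (by rw [Set.uIcc_of_le h01])).intervalIntegrable)
  · rw [Set.indicator_of_notMem hy]
    refine integral_eq_zero_of_ae (Filter.Eventually.of_forall fun x => ?_)
    refine Set.indicator_of_notMem (fun h => hy ?_) _
    have h3 := h.2.2
    have h4 := h.1
    simp only at h3 h4
    exact ⟨h.2.1, by linarith⟩

/-- An integral over the standard `2`-simplex is an integral over a triangle in `ℝ × ℝ`. -/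
lemma setIntegral_stdSimp_two (G : (Fin 2 → ℝ) → ℝ) :
    ∫ x in stdSimp 2, G x =
      ∫ p in {p : ℝ × ℝ | 0 ≤ p.1 ∧ 0 ≤ p.2 ∧ p.1 + p.2 ≤ 1}, G ![p.1, p.2] := by
  have h := ((volume_preserving_finTwoArrow ℝ).symm _).setIntegral_preimage_emb
    (MeasurableEquiv.measurableEmbedding _) G (stdSimp 2)
  have hset : (MeasurableEquiv.finTwoArrow (α := ℝ)).symm ⁻¹' stdSimp 2 =
      {p : ℝ × ℝ | 0 ≤ p.1 ∧ 0 ≤ p.2 ∧ p.1 + p.2 ≤ 1} := by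
    ext p
    simp [stdSimp, Fin.forall_fin_two, and_assoc]
  rw [← hset]
  exact h.symm

lemma setIntegral_triangle_swap (G : ℝ → ℝ → ℝ) :
    ∫ p in {p : ℝ × ℝ | 0 ≤ p.1 ∧ 0 ≤ p.2 ∧ p.1 + p.2 ≤ 1}, G p.1 p.2 =
      ∫ p in {p : ℝ × ℝ | 0 ≤ p.1 ∧ 0 ≤ p.2 ∧ p.1 + p.2 ≤ 1}, G p.2 p.1 := by
  have h := (Measure.measurePreserving_swap (μ := (volume : Measure ℝ))
    (ν := (volume : Measure ℝ))).setIntegral_preimage_emb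
      MeasurableEquiv.prodComm.measurableEmbedding (fun p => G p.1 p.2)
      {p : ℝ × ℝ | 0 ≤ p.1 ∧ 0 ≤ p.2 ∧ p.1 + p.2 ≤ 1}
  have hset : Prod.swap ⁻¹' {p : ℝ × ℝ | 0 ≤ p.1 ∧ 0 ≤ p.2 ∧ p.1 + p.2 ≤ 1} =
      {p : ℝ × ℝ | 0 ≤ p.1 ∧ 0 ≤ p.2 ∧ p.1 + p.2 ≤ 1} := by
    ext p
    simp only [Set.mem_preimage, Prod.fst_swap, Prod.snd_swap, Set.mem_ofPred_eq, add_comm p.2]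
    tauto
  rw [hset] at h
  exact h.symm

lemma hasDerivAt_of_contDiffOn_stdSimp {f : (Fin 2 → ℝ) → ℝ}
    (hf : ContDiffOn ℝ ∞ f (stdSimp 2)) {c : ℝ → Fin 2 → ℝ} {v : Fin 2 → ℝ} {t : ℝ}
    (hc : HasDerivAt c v t) (h0 : ∀ i, 0 < c t i) (h1 : ∑ i, c t i < 1) :
    HasDerivAt (fun t => f (c t)) (fderivWithin ℝ f (stdSimp 2) (c t) v) t := by
  have hn := stdSimp_mem_nhds h0 h1
  rw [fderivWithin_of_mem_nhds hn]
  exact ((hf.contDiffAt hn).differentiableAt (by simp)).hasFDerivAt.comp_hasDerivAt t hc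

lemma continuousOn_stdSimp_two_comp {f : (Fin 2 → ℝ) → ℝ} (hf : ContinuousOn f (stdSimp 2)) :
    ContinuousOn (fun p : ℝ × ℝ => f ![p.1, p.2])
      {p | 0 ≤ p.1 ∧ 0 ≤ p.2 ∧ p.1 + p.2 ≤ 1} := by
  refine hf.comp (by fun_prop) fun p hp => ?_
  simpa [stdSimp, Fin.forall_fin_two, and_assoc] using hp

lemma setIntegral_fderivWithin_zero {f : (Fin 2 → ℝ) → ℝ} (hf : ContDiffOn ℝ ∞ f (stdSimp 2)) :
    ∫ x in stdSimp 2, fderivWithin ℝ f (stdSimp 2) x (Pi.single 0 1) =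
      ∫ t in (0 : ℝ)..1, f ![1 - t, t] - f ![0, t] := by
  rw [setIntegral_stdSimp_two]
  refine integral_triangle (Q := fun x y => f ![x, y])
    (Q' := fun x y => fderivWithin ℝ f (stdSimp 2) ![x, y] (Pi.single 0 1))
    (continuousOn_stdSimp_two_comp hf.continuousOn)
    (continuousOn_stdSimp_two_comp ((hf.continuousOn_fderivWithin (uniqueDiffOn_stdSimp 2)
      (by simp)).clm_apply continuousOn_const)) fun x y hx hy hxy => ?_
  refine hasDerivAt_of_contDiffOn_stdSimp hf (c := fun x => ![x, y]) ?_
    (by simp [Fin.forall_fin_two, hx, hy]) (by simpa using hxy)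
  refine hasDerivAt_pi.2 fun i => ?_
  fin_cases i
  · simpa using hasDerivAt_id' x
  · simpa using hasDerivAt_const x y

lemma setIntegral_fderivWithin_one {f : (Fin 2 → ℝ) → ℝ} (hf : ContDiffOn ℝ ∞ f (stdSimp 2)) :
    ∫ x in stdSimp 2, fderivWithin ℝ f (stdSimp 2) x (Pi.single 1 1) =
      ∫ t in (0 : ℝ)..1, f ![1 - t, t] - f ![1 - t, 0] := by
  have hswap : ∀ {s : Set (ℝ × ℝ)} {g : ℝ → ℝ → ℝ}, s = {p | 0 ≤ p.1 ∧ 0 ≤ p.2 ∧ p.1 + p.2 ≤ 1} →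
      ContinuousOn (fun p : ℝ × ℝ => g p.1 p.2) s → ContinuousOn (fun p : ℝ × ℝ => g p.2 p.1) s := by
    rintro _ g rfl hg
    refine hg.comp (g := fun p : ℝ × ℝ => g p.1 p.2) continuous_swap.continuousOn fun p hp => ?_
    exact ⟨hp.2.1, hp.1, by simpa [add_comm] using hp.2.2⟩
  rw [setIntegral_stdSimp_two, setIntegral_triangle_swap
    (fun x y => fderivWithin ℝ f (stdSimp 2) ![x, y] (Pi.single 1 1))]
  refine (integral_triangle (Q := fun y x => f ![x, y])
    (Q' := fun y x => fderivWithin ℝ f (stdSimp 2) ![x, y] (Pi.single 1 1))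
    (hswap (g := fun x y => f ![x, y]) rfl (continuousOn_stdSimp_two_comp hf.continuousOn))
    (hswap (g := fun x y => fderivWithin ℝ f (stdSimp 2) ![x, y] (Pi.single 1 1)) rfl
      (continuousOn_stdSimp_two_comp ((hf.continuousOn_fderivWithin (uniqueDiffOn_stdSimp 2)
      (by simp)).clm_apply continuousOn_const))) fun y x hy hx hxy => ?_).trans ?_
  · refine hasDerivAt_of_contDiffOn_stdSimp hf (c := fun y => ![x, y]) ?_
      (by simp [Fin.forall_fin_two, hx, hy]) (by simpa [add_comm] using hxy)
    refine hasDerivAt_pi.2 fun i => ?_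
    fin_cases i
    · simpa using hasDerivAt_const y x
    · simpa using hasDerivAt_id' y
  · have := intervalIntegral.integral_comp_sub_left (a := 0) (b := 1)
      (fun t => f ![t, 1 - t] - f ![t, 0]) 1
    simpa using this.symm

end Calculus

section Faces

lemma faceIncl_zero (x : Fin 1 → ℝ) : faceIncl 0 x = ![1 - x 0, x 0] := by
  ext j
  fin_cases j <;> simp [faceIncl, baryCoord, Fin.sum_univ_succ]

lemma faceIncl_one (x : Fin 1 → ℝ) : faceIncl 1 x = ![0, x 0] := by
  ext j
  fin_cases j <;> simp [faceIncl, baryCoord, Fin.sum_univ_succ, Fin.succAbove, Fin.lt_def]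

lemma faceIncl_two (x : Fin 1 → ℝ) : faceIncl 2 x = ![x 0, 0] := by
  ext j
  fin_cases j <;> simp [faceIncl, baryCoord, Fin.sum_univ_succ, Fin.succAbove, Fin.lt_def]

end Faces

section Stokes

open MeasureTheory DiffForm

variable {E : Type*} [NormedAddCommGroup E] [NormedSpace ℝ E] {H : Type*} [TopologicalSpace H]
  {I : ModelWithCorners ℝ E H} {M : Type*} [TopologicalSpace M] [ChartedSpace H M]

/-- The integral of a `1`-form over an edge of a `2`-simplex. -/
lemma SmoothSimplex.integral_face (η : DiffForm I M 1) (σ : SmoothSimplex I M 2) (i : Fin 3)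
    {c a : Fin 2 → ℝ} (hca : ∀ x : Fin 1 → ℝ, faceIncl i x = c + x 0 • a) :
    (σ.face i).integral η =
      ∫ t in (0 : ℝ)..1, pullbackWithin σ.toFun (stdSimp 2) η (c + t • a) fun _ => a := by
  rw [SmoothSimplex.integral, ← setIntegral_stdSimp_one fun x =>
    pullbackWithin σ.toFun (stdSimp 2) η (c + x 0 • a) fun _ => a]
  refine setIntegral_congr_fun (measurableSet_stdSimp 1) fun x hx => ?_
  have hmem := faceIncl_mem i hx
  have hfi : HasFDerivAt (faceIncl (k := 1) i)
      ((ContinuousLinearMap.proj (R := ℝ) (φ := fun _ : Fin 1 => ℝ) 0).smulRight a) x := by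
    rw [funext hca]
    exact ((ContinuousLinearMap.proj (R := ℝ) (φ := fun _ : Fin 1 => ℝ) 0).hasFDerivAt.smul_const
      a).const_add c
  have hud := uniqueDiffOn_stdSimp 1 x hx
  have h1 := mfderivWithin_comp x ((σ.smooth _ hmem).mdifferentiableWithinAt (by simp))
    hfi.hasFDerivWithinAt.differentiableWithinAt.mdifferentiableWithinAt
    (s := stdSimp 1) (fun z hz => faceIncl_mem i hz) hud.uniqueMDiffWithinAt
  rw [mfderivWithin_eq_fderivWithin, hfi.hasFDerivWithinAt.fderivWithin hud] at h1
  have hface : Set.EqOn (σ.face i).toFun (σ.toFun ∘ faceIncl i) (stdSimp 1) := fun z hz => if_pos hz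
  have h2 := mfderivWithin_congr_of_mem (I := 𝓘(ℝ, Fin 1 → ℝ)) (I' := I) hface hx
  have h3 : ∀ j : Fin 1, (mfderivWithin 𝓘(ℝ, Fin 1 → ℝ) I (σ.face i).toFun (stdSimp 1) x
      (Pi.single j (1 : ℝ) : Fin 1 → ℝ) : E) =
        mfderivWithin 𝓘(ℝ, Fin 2 → ℝ) I σ.toFun (stdSimp 2) (faceIncl i x) a := fun j => by
    have h4 := DFunLike.congr_fun (h2.trans h1) (Pi.single j (1 : ℝ) : Fin 1 → ℝ)
    refine h4.trans ?_
    refine congrArg (mfderivWithin 𝓘(ℝ, Fin 2 → ℝ) I σ.toFun (stdSimp 2) (faceIncl i x)) ?_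
    change (Pi.single j (1 : ℝ) : Fin 1 → ℝ) 0 • a = a
    simp [Subsingleton.elim j 0]
  rw [← hca]
  refine (apply_congr_point η (hface hx) _).trans ?_
  exact congrArg (η (σ.toFun (faceIncl i x))) (funext h3)

/-- Stokes' theorem for a `2`-simplex. -/
theorem SmoothSimplex.integral_extD [IsManifold I ∞ M] {η : DiffForm I M 1} (hη : η.Smooth)
    (σ : SmoothSimplex I M 2) :
    σ.integral η.extD =
      (σ.face 0).integral η - (σ.face 1).integral η + (σ.face 2).integral η := by
  set θ := pullbackWithin σ.toFun (stdSimp 2) η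
  have hud := uniqueDiffOn_stdSimp 2
  have hθ : ContDiffOn ℝ ∞ θ (stdSimp 2) := hη.contDiffOn_pullbackWithin hud σ.smooth
  have hev : ∀ v : Fin 1 → Fin 2 → ℝ, ContDiffOn ℝ ∞ (fun x => θ x v) (stdSimp 2) := fun v =>
    ((ContinuousAlternatingMap.apply ℝ (Fin 2 → ℝ) ℝ v).contDiff.comp_contDiffOn hθ)
  set e : Fin 2 → Fin 2 → ℝ := fun j => Pi.single j 1
  set f : Fin 2 → (Fin 2 → ℝ) → ℝ := fun j x => θ x fun _ => e j
  have hf : ∀ j, ContDiffOn ℝ ∞ (f j) (stdSimp 2) := fun j => hev _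
  have hD : σ.integral η.extD = ∫ x in stdSimp 2,
      (fderivWithin ℝ (f 1) (stdSimp 2) x (e 0) - fderivWithin ℝ (f 0) (stdSimp 2) x (e 1)) := by
    refine setIntegral_congr_fun (measurableSet_stdSimp 2) fun x hx => ?_
    have h1 := hη.extDerivWithin_pullbackWithin hud σ.smooth hx
      (subset_closure_interior_stdSimp 2 hx)
    have h2 := extDerivWithin_apply ((hθ x hx).differentiableWithinAt (by simp)) (hud x hx) e
    rw [h1] at h2
    refine Eq.trans (show _ = pullbackWithin σ.toFun (stdSimp 2) η.extD x e from rfl) (h2.trans ?_)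
    have hr0 : (0 : Fin 2).removeNth e = fun _ => e 1 := by
      funext j; simp [Fin.removeNth, Subsingleton.elim j 0]
    have hr1 : (1 : Fin 2).removeNth e = fun _ => e 0 := by
      funext j; simp [Fin.removeNth, Subsingleton.elim j 0]
    simp [Fin.sum_univ_two, hr0, hr1, f, sub_eq_add_neg]
  have hint : ∀ j l, IntegrableOn (fun x => fderivWithin ℝ (f j) (stdSimp 2) x (e l)) (stdSimp 2) :=
    fun j l => (((hf j).continuousOn_fderivWithin hud (by simp)).clm_apply
      continuousOn_const).integrableOn_compact (isCompact_stdSimp 2)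
  have hii : ∀ (v : Fin 1 → Fin 2 → ℝ) (c a : Fin 2 → ℝ),
      (∀ t ∈ Set.Icc (0 : ℝ) 1, c + t • a ∈ stdSimp 2) →
      IntervalIntegrable (fun t : ℝ => θ (c + t • a) v) volume 0 1 := fun v c a h => by
    refine ContinuousOn.intervalIntegrable ?_
    rw [Set.uIcc_of_le zero_le_one]
    exact (hev v).continuousOn.comp (by fun_prop) h
  have hF0 := σ.integral_face η 0 (c := ![1, 0]) (a := ![-1, 1]) fun x => by
    rw [faceIncl_zero]; ext j; fin_cases j <;> simp [sub_eq_add_neg]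
  have hF1 := σ.integral_face η 1 (c := ![0, 0]) (a := ![0, 1]) fun x => by
    rw [faceIncl_one]; ext j; fin_cases j <;> simp
  have hF2 := σ.integral_face η 2 (c := ![0, 0]) (a := ![1, 0]) fun x => by
    rw [faceIncl_two]; ext j; fin_cases j <;> simp
  have hm0 : ∀ t ∈ Set.Icc (0 : ℝ) 1, (![1, 0] + t • ![-1, 1] : Fin 2 → ℝ) ∈ stdSimp 2 :=
    fun t ht => by simp [stdSimp, Fin.forall_fin_two, ht.1, ht.2]
  have hm1 : ∀ t ∈ Set.Icc (0 : ℝ) 1, (![0, 0] + t • ![0, 1] : Fin 2 → ℝ) ∈ stdSimp 2 :=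
    fun t ht => by simp [stdSimp, Fin.forall_fin_two, ht.1, ht.2]
  have hm2 : ∀ t ∈ Set.Icc (0 : ℝ) 1, (![1, 0] + t • ![-1, 0] : Fin 2 → ℝ) ∈ stdSimp 2 :=
    fun t ht => by simp [stdSimp, Fin.forall_fin_two, ht.1, ht.2]
  have he0 : e 0 = ![1, 0] := by ext j; fin_cases j <;> simp [e]
  have he1 : e 1 = ![0, 1] := by ext j; fin_cases j <;> simp [e]
  have hp0 : ∀ t : ℝ, (![1, 0] + t • ![-1, 1] : Fin 2 → ℝ) = ![1 - t, t] := fun t => by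
    ext j; fin_cases j <;> simp [sub_eq_add_neg]
  have hp1 : ∀ t : ℝ, (![0, 0] + t • ![0, 1] : Fin 2 → ℝ) = ![0, t] := fun t => by
    ext j; fin_cases j <;> simp
  have hp2 : ∀ t : ℝ, (![1, 0] + t • ![-1, 0] : Fin 2 → ℝ) = ![1 - t, 0] := fun t => by
    ext j; fin_cases j <;> simp [sub_eq_add_neg]
  have hp3 : ∀ t : ℝ, (![0, 0] + t • ![1, 0] : Fin 2 → ℝ) = ![t, 0] := fun t => by
    ext j; fin_cases j <;> simp
  have hsub : ∀ x, (θ x fun _ => ![-1, 1]) = f 1 x - f 0 x := fun x => by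
    have h1 : (fun _ : Fin 1 => (![-1, 1] : Fin 2 → ℝ)) = fun _ => e 1 - e 0 := by
      funext j; rw [he0, he1]; ext l; fin_cases l <;> simp
    have h2 := (θ x).map_update_sub (fun _ : Fin 1 => (0 : Fin 2 → ℝ)) 0 (e 1) (e 0)
    have h3 : ∀ v : Fin 2 → ℝ, Function.update (fun _ : Fin 1 => (0 : Fin 2 → ℝ)) 0 v =
      fun _ => v := fun v => by funext j; simp [Subsingleton.elim j 0]
    simp only [h3] at h2
    rw [h1]; exact h2
  have hrev : ∫ t in (0 : ℝ)..1, f 0 ![1 - t, 0] = ∫ t in (0 : ℝ)..1, f 0 ![t, 0] := by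
    have := intervalIntegral.integral_comp_sub_left (a := 0) (b := 1) (fun t => f 0 ![t, 0]) 1
    simpa using this
  have hi := fun j => hii (fun _ => e j) _ _ hm0
  have hi1 := fun j => hii (fun _ => e j) _ _ hm1
  have hi2 := fun j => hii (fun _ => e j) _ _ hm2
  simp only [hp0, hp1, hp2] at hi hi1 hi2
  simp only [hp0, hp1, hp3] at hF0 hF1 hF2
  rw [hD, integral_sub (hint 1 0) (hint 0 1), setIntegral_fderivWithin_zero (hf 1),
    setIntegral_fderivWithin_one (hf 0), hF0, hF1, hF2,
    intervalIntegral.integral_sub (hi 1) (hi1 1), intervalIntegral.integral_sub (hi 0) (hi2 0),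
    hrev, ← he0, ← he1]
  change _ = (∫ t in (0 : ℝ)..1, θ ![1 - t, t] fun _ => ![-1, 1]) - _ + _
  simp only [hsub]
  rw [intervalIntegral.integral_sub (hi 1) (hi 0)]
  ring

lemma chainIntegral_single {k : ℕ} (Ω : DiffForm I M k) (σ : SmoothSimplex I M k) :
    chainIntegral Ω (Finsupp.single σ 1) = σ.integral Ω := by
  simp [chainIntegral]

lemma boundary_single {k : ℕ} (σ : SmoothSimplex I M (k + 1)) :
    boundary k (Finsupp.single σ 1) =
      ∑ i : Fin (k + 2), (-1 : ℤ) ^ (i : ℕ) • Finsupp.single (σ.face i) 1 := by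
  simp [boundary]

/-- Stokes' theorem for `2`-chains. -/
theorem chainIntegral_extD [IsManifold I ∞ M] {η : DiffForm I M 1} (hη : η.Smooth)
    (C : SmoothChain I M 2) : chainIntegral η.extD C = chainIntegral η (boundary 1 C) := by
  have key : chainIntegral (I := I) (M := M) η.extD = (chainIntegral η).comp (boundary 1) := by
    ext1 σ
    ext1
    have := σ.integral_extD hη
    change chainIntegral η.extD (Finsupp.single σ 1) =
      chainIntegral η (boundary 1 (Finsupp.single σ 1))
    rw [boundary_single, map_sum, chainIntegral_single, this]
    simp only [map_zsmul, chainIntegral_single]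
    refine Eq.trans ?_ (Fin.sum_univ_three _).symm
    simp [sub_eq_add_neg]
  exact DFunLike.congr_fun key C

end Stokes

section Homotopy

open MeasureTheory DiffForm

variable {E : Type*} [NormedAddCommGroup E] [NormedSpace ℝ E] {H : Type*} [TopologicalSpace H]
  {I : ModelWithCorners ℝ E H} {M : Type*} [TopologicalSpace M] [ChartedSpace H M]
  {E' : Type*} [NormedAddCommGroup E'] [NormedSpace ℝ E'] {H' : Type*} [TopologicalSpace H']
  {J : ModelWithCorners ℝ E' H'} {N : Type*} [TopologicalSpace N] [ChartedSpace H' N]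

lemma ContinuousAlternatingMap.map_pair_add_smul_left {V : Type*} [NormedAddCommGroup V]
    [NormedSpace ℝ V] (W : V [⋀^Fin 2]→L[ℝ] ℝ) (r s : ℝ) (u v w : V) :
    W ![r • u + s • v, w] = r * W ![u, w] + s * W ![v, w] := by
  have h1 := W.toMultilinearMap.cons_add ![w] (r • u) (s • v)
  have h2 := W.toMultilinearMap.cons_smul ![w] r u
  have h3 := W.toMultilinearMap.cons_smul ![w] s v
  exact h1.trans (congrArg₂ (· + ·) h2 h3)

/-- A `2`-form with `v` in its kernel vanishes on a plane spanned by `v` and another vector. -/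
lemma ContinuousAlternatingMap.map_pair_eq_zero {V : Type*} [NormedAddCommGroup V]
    [NormedSpace ℝ V] (W : V [⋀^Fin 2]→L[ℝ] ℝ) {v : V} (hv : ∀ w, W ![v, w] = 0) (u : V)
    (r s r' s' : ℝ) : W ![r • u + s • v, r' • u + s' • v] = 0 := by
  have hswap : ∀ a b, W ![a, b] = -W ![b, a] := fun a b => by
    have h := W.toAlternatingMap.map_swap ![b, a] (i := 0) (j := 1) (by decide)
    have h2 : (![b, a] ∘ Equiv.swap (0 : Fin 2) 1) = ![a, b] := by
      ext j; fin_cases j <;> simp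
    rw [h2] at h
    exact h
  have hself : W ![u, u] = 0 := W.map_eq_zero_of_eq ![u, u] (i := 0) (j := 1) rfl (by decide)
  rw [W.map_pair_add_smul_left, hv, hswap, W.map_pair_add_smul_left, hv, hself]
  simp

open Classical in
/-- The smooth simplex given by a map that is smooth on the standard simplex. -/
noncomputable def SmoothSimplex.ofContMDiffOn {k : ℕ} (g : (Fin k → ℝ) → M)
    (hg : ContMDiffOn 𝓘(ℝ, Fin k → ℝ) I ∞ g (stdSimp k)) : SmoothSimplex I M k where
  toFun x := if x ∈ stdSimp k then g x else g 0
  smooth := hg.congr fun x hx => if_pos hx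
  junk x hx := by rw [if_neg hx, if_pos (zero_mem_stdSimp k)]

lemma SmoothSimplex.ofContMDiffOn_apply {k : ℕ} {g : (Fin k → ℝ) → M}
    (hg : ContMDiffOn 𝓘(ℝ, Fin k → ℝ) I ∞ g (stdSimp k)) {x : Fin k → ℝ} (hx : x ∈ stdSimp k) :
    (ofContMDiffOn g hg).toFun x = g x := if_pos hx

lemma SmoothSimplex.ext_of_eqOn {k : ℕ} {σ τ : SmoothSimplex I M k}
    (h : Set.EqOn σ.toFun τ.toFun (stdSimp k)) : σ = τ := by
  ext x
  by_cases hx : x ∈ stdSimp k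
  · exact h hx
  · rw [σ.junk x hx, τ.junk x hx, h (zero_mem_stdSimp k)]

lemma SmoothSimplex.face_apply {k : ℕ} (σ : SmoothSimplex I M (k + 1)) (i : Fin (k + 2))
    {x : Fin k → ℝ} (hx : x ∈ stdSimp k) : (σ.face i).toFun x = σ.toFun (faceIncl i x) := if_pos hx

lemma contMDiffOn_track (P : M × ℝ → N) (hP : ContMDiff (I.prod 𝓘(ℝ, ℝ)) J ∞ P)
    (σ : SmoothSimplex I M 1) {k : ℕ} {a b : (Fin k → ℝ) → ℝ} (ha : ContDiff ℝ ∞ a)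
    (hb : ContDiff ℝ ∞ b) (ha01 : Set.MapsTo a (stdSimp k) (Set.Icc 0 1)) :
    ContMDiffOn 𝓘(ℝ, Fin k → ℝ) J ∞ (fun x => P (σ.toFun (fun _ => a x), b x)) (stdSimp k) := by
  have h1 : ContMDiffOn 𝓘(ℝ, Fin k → ℝ) I ∞ (fun x => σ.toFun fun _ => a x) (stdSimp k) :=
    σ.smooth.comp (g := σ.toFun) (f := fun x (_ : Fin 1) => a x)
      (contDiff_pi.2 fun _ => ha).contMDiff.contMDiffOn
      fun x hx => by simpa [stdSimp] using ha01 hx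
  exact hP.comp_contMDiffOn (h1.prodMk hb.contMDiff.contMDiffOn)

/-- A `2`-form whose pullback under `P` has `∂_t` in its kernel integrates to zero over the
`2`-simplices that lie in the track of a curve. -/
lemma integral_track_eq_zero (P : M × ℝ → N) (hP : ContMDiff (I.prod 𝓘(ℝ, ℝ)) J ∞ P)
    {Θ : DiffForm J N 2}
    (hΘ : ∀ (p : M × ℝ) (w : E × ℝ), (pullback (I := I.prod 𝓘(ℝ, ℝ)) P Θ) p ![((0, 1) : E × ℝ), w] = 0)
    (σ : SmoothSimplex I M 1) {a b : (Fin 2 → ℝ) → ℝ} (ha : ContDiff ℝ ∞ a)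
    (hb : ContDiff ℝ ∞ b) (ha01 : Set.MapsTo a (stdSimp 2) (Set.Icc 0 1)) :
    (SmoothSimplex.ofContMDiffOn _ (contMDiffOn_track P hP σ ha hb ha01)).integral Θ = 0 := by
  set τ := SmoothSimplex.ofContMDiffOn _ (contMDiffOn_track P hP σ ha hb ha01) with hτ
  refine setIntegral_eq_zero_of_forall_eq_zero fun x hx => ?_
  set c : (Fin 2 → ℝ) → Fin 1 → ℝ := fun x _ => a x
  have hc : ContDiff ℝ ∞ c := contDiff_pi.2 fun _ => ha
  have hcmaps : Set.MapsTo c (stdSimp 2) (stdSimp 1) := fun x hx => by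
    simpa [c, stdSimp] using ha01 hx
  set m : (Fin 2 → ℝ) → M × ℝ := fun x => (σ.toFun (c x), b x)
  have hud := (uniqueDiffOn_stdSimp 2 x hx).uniqueMDiffWithinAt
  have hσ := (σ.smooth (c x) (hcmaps hx)).mdifferentiableWithinAt (by simp)
  have hcd : MDifferentiableWithinAt 𝓘(ℝ, Fin 2 → ℝ) 𝓘(ℝ, Fin 1 → ℝ) c (stdSimp 2) x :=
    (hc.contMDiff x).contMDiffWithinAt.mdifferentiableWithinAt (by simp)
  have hbd : MDifferentiableWithinAt 𝓘(ℝ, Fin 2 → ℝ) 𝓘(ℝ, ℝ) b (stdSimp 2) x :=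
    (hb.contMDiff x).contMDiffWithinAt.mdifferentiableWithinAt (by simp)
  have hσc := hσ.comp x hcd hcmaps
  have h1 := mfderivWithin_comp x hσ hcd hcmaps hud
  have h2 := mfderivWithin_prodMk hσc hbd hud
  have h3 := mfderiv_comp_mfderivWithin x (hP.mdifferentiable (by simp) (m x))
    (hσc.prodMk hbd) hud
  have h4 := mfderivWithin_congr_of_mem (I := 𝓘(ℝ, Fin 2 → ℝ)) (I' := J)
    (show Set.EqOn τ.toFun (P ∘ m) (stdSimp 2) from
      fun z hz => SmoothSimplex.ofContMDiffOn_apply _ hz) hx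
  set A : (Fin 1 → ℝ) →L[ℝ] E := mfderivWithin 𝓘(ℝ, Fin 1 → ℝ) I σ.toFun (stdSimp 1) (c x)
  set C : (Fin 2 → ℝ) →L[ℝ] Fin 1 → ℝ := mfderivWithin 𝓘(ℝ, Fin 2 → ℝ) 𝓘(ℝ, Fin 1 → ℝ) c (stdSimp 2) x
  set B : (Fin 2 → ℝ) →L[ℝ] ℝ := mfderivWithin 𝓘(ℝ, Fin 2 → ℝ) 𝓘(ℝ, ℝ) b (stdSimp 2) x
  have h5 : ∀ w : Fin 2 → ℝ, (mfderivWithin 𝓘(ℝ, Fin 2 → ℝ) J τ.toFun (stdSimp 2) x w : E') =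
      mfderiv (I.prod 𝓘(ℝ, ℝ)) J P (m x) (((C w 0) • (A fun _ => 1, 0) + B w • (0, 1) : E × ℝ)) :=
    fun w => by
      have h6 := DFunLike.congr_fun (h4.trans h3) w
      refine h6.trans (congrArg (mfderiv (I.prod 𝓘(ℝ, ℝ)) J P (m x)) ?_)
      refine (DFunLike.congr_fun h2 w).trans ?_
      have h7 : (A (C w) : E) = C w 0 • A fun _ => 1 := by
        rw [← map_smul]
        congr 1
        funext j
        simp [Subsingleton.elim j 0]
      refine Prod.ext ?_ ?_
      · refine (DFunLike.congr_fun h1 w).trans ?_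
        change A (C w) = _
        rw [h7]
        simp
      · change B w = _
        simp
  refine (apply_congr_point Θ (SmoothSimplex.ofContMDiffOn_apply _ hx) _).trans ?_
  refine Eq.trans ?_ (ContinuousAlternatingMap.map_pair_eq_zero
    (pullback (I := I.prod 𝓘(ℝ, ℝ)) P Θ (m x) : (E × ℝ) [⋀^Fin 2]→L[ℝ] ℝ) (hΘ (m x))
    (A fun _ => 1, 0) (C (Pi.single 0 1) 0) (B (Pi.single 0 1)) (C (Pi.single 1 1) 0)
    (B (Pi.single 1 1)))
  refine congrArg (Θ (P (m x))) (funext fun j => (h5 _).trans ?_)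
  fin_cases j <;> rfl

/-- The curve `t ↦ P (q, t)` for `t ∈ [0, 1]`. -/
noncomputable def verticalSimplex (P : M × ℝ → N) (hP : ContMDiff (I.prod 𝓘(ℝ, ℝ)) J ∞ P) (q : M) :
    SmoothSimplex J N 1 :=
  SmoothSimplex.ofContMDiffOn (fun x => P (q, x 0)) <|
    (hP.comp (contMDiff_const.prodMk
      (contDiff_apply ℝ ℝ (0 : Fin 1)).contMDiff)).contMDiffOn

lemma contMDiff_slice {P : M × ℝ → N} (hP : ContMDiff (I.prod 𝓘(ℝ, ℝ)) J ∞ P) (t : ℝ) :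
    ContMDiff I J ∞ fun x => P (x, t) :=
  hP.comp (contMDiff_id.prodMk contMDiff_const)

/-- The homotopy formula for a curve. -/
lemma integral_map_slice_sub [IsManifold J ∞ N] {P : M × ℝ → N}
    (hP : ContMDiff (I.prod 𝓘(ℝ, ℝ)) J ∞ P) {η : DiffForm J N 1} (hη : η.Smooth)
    (hker : ∀ (p : M × ℝ) (w : E × ℝ),
      (pullback (I := I.prod 𝓘(ℝ, ℝ)) P η.extD) p ![((0, 1) : E × ℝ), w] = 0)
    (σ : SmoothSimplex I M 1) :
    (σ.map _ (contMDiff_slice hP 1)).integral η - (σ.map _ (contMDiff_slice hP 0)).integral η =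
      (verticalSimplex P hP (σ.toFun fun _ => 1)).integral η -
        (verticalSimplex P hP (σ.toFun 0)).integral η := by
  have hx0 : ContDiff ℝ ∞ fun x : Fin 2 → ℝ => x 0 := contDiff_apply ℝ ℝ (0 : Fin 2)
  have hx1 : ContDiff ℝ ∞ fun x : Fin 2 → ℝ => x 1 := contDiff_apply ℝ ℝ (1 : Fin 2)
  have hm1 : Set.MapsTo (fun x : Fin 2 → ℝ => x 1) (stdSimp 2) (Set.Icc 0 1) := fun x hx => by
    have h2 : x 0 + x 1 ≤ 1 := by simpa using hx.2
    exact ⟨hx.1 1, by linarith [hx.1 0]⟩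
  have hm2 : Set.MapsTo (fun x : Fin 2 → ℝ => x 0 + x 1) (stdSimp 2) (Set.Icc 0 1) := fun x hx => by
    have h2 : x 0 + x 1 ≤ 1 := by simpa using hx.2
    exact ⟨add_nonneg (hx.1 0) (hx.1 1), h2⟩
  have hz1 := integral_track_eq_zero P hP hker σ (hx0.add hx1) hx1 hm2
  have hz2 := integral_track_eq_zero P hP hker σ hx1 (hx0.add hx1) hm1
  set τ₁ := SmoothSimplex.ofContMDiffOn _ (contMDiffOn_track P hP σ (hx0.add hx1) hx1 hm2)
  set τ₂ := SmoothSimplex.ofContMDiffOn _ (contMDiffOn_track P hP σ hx1 (hx0.add hx1) hm1)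
  rw [SmoothSimplex.integral_extD hη] at hz1 hz2
  have hτ₁ : ∀ (i : Fin 3) {x : Fin 1 → ℝ}, x ∈ stdSimp 1 → (τ₁.face i).toFun x =
      P (σ.toFun (fun _ => faceIncl i x 0 + faceIncl i x 1), faceIncl i x 1) := fun i x hx =>
    (τ₁.face_apply i hx).trans (SmoothSimplex.ofContMDiffOn_apply _ (faceIncl_mem i hx))
  have hτ₂ : ∀ (i : Fin 3) {x : Fin 1 → ℝ}, x ∈ stdSimp 1 → (τ₂.face i).toFun x =
      P (σ.toFun (fun _ => faceIncl i x 1), faceIncl i x 0 + faceIncl i x 1) := fun i x hx =>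
    (τ₂.face_apply i hx).trans (SmoothSimplex.ofContMDiffOn_apply _ (faceIncl_mem i hx))
  have heta : ∀ x : Fin 1 → ℝ, (fun _ => x 0) = x := fun x => by
    funext j; rw [Subsingleton.elim j 0]
  have h10 : τ₁.face 0 = verticalSimplex P hP (σ.toFun fun _ => 1) :=
    SmoothSimplex.ext_of_eqOn fun x hx => by
      rw [hτ₁ 0 hx, verticalSimplex, SmoothSimplex.ofContMDiffOn_apply _ hx, faceIncl_zero]
      simp
  have h12 : τ₁.face 2 = σ.map _ (contMDiff_slice hP 0) :=
    SmoothSimplex.ext_of_eqOn fun x hx => by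
      rw [hτ₁ 2 hx, faceIncl_two]
      simp [SmoothSimplex.map, heta]
  have h20 : τ₂.face 0 = σ.map _ (contMDiff_slice hP 1) :=
    SmoothSimplex.ext_of_eqOn fun x hx => by
      rw [hτ₂ 0 hx, faceIncl_zero]
      simp [SmoothSimplex.map, heta]
  have h22 : τ₂.face 2 = verticalSimplex P hP (σ.toFun 0) :=
    SmoothSimplex.ext_of_eqOn fun x hx => by
      rw [hτ₂ 2 hx, verticalSimplex, SmoothSimplex.ofContMDiffOn_apply _ hx, faceIncl_two]
      simp [Pi.zero_def]
  have h11 : τ₁.face 1 = τ₂.face 1 :=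
    SmoothSimplex.ext_of_eqOn fun x hx => by
      rw [hτ₁ 1 hx, hτ₂ 1 hx, faceIncl_one]
      simp
  rw [h10, h12, h11] at hz1
  rw [h20, h22] at hz2
  linarith

/-- If `∂_t` is in the kernel of the pullback of `dη` under `P : M × ℝ → N`, then `η` has the same
integral over the images of a cycle under `P(·, 0)` and `P(·, 1)`. -/
theorem chainIntegral_slice_eq [IsManifold J ∞ N] {P : M × ℝ → N}
    (hP : ContMDiff (I.prod 𝓘(ℝ, ℝ)) J ∞ P) {η : DiffForm J N 1} (hη : η.Smooth)
    (hker : ∀ (p : M × ℝ) (w : E × ℝ),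
      (pullback (I := I.prod 𝓘(ℝ, ℝ)) P η.extD) p ![((0, 1) : E × ℝ), w] = 0)
    {γ : SmoothChain I M 1} (hγ : γ ∈ oneCycles I M) :
    chainIntegral η (chainMap _ (contMDiff_slice hP 1) 1 γ) =
      chainIntegral η (chainMap _ (contMDiff_slice hP 0) 1 γ) := by
  let Φ : SmoothChain I M 0 →+ ℝ := Finsupp.liftAddHom fun ρ =>
    (zmultiplesHom ℝ) ((verticalSimplex P hP (ρ.toFun 0)).integral η)
  have hΦ : ∀ ρ, Φ (Finsupp.single ρ 1) = (verticalSimplex P hP (ρ.toFun 0)).integral η :=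
    fun ρ => by simp [Φ]
  have key : (chainIntegral η).comp (chainMap _ (contMDiff_slice hP 1) 1) -
      (chainIntegral η).comp (chainMap _ (contMDiff_slice hP 0) 1) =
        Φ.comp (boundary (I := I) (M := M) 0) := by
    ext1 σ
    ext1
    have hmap : ∀ (f : M → N) (hf : ContMDiff I J ∞ f), chainMap f hf 1 (Finsupp.single σ 1) =
        Finsupp.single (σ.map f hf) 1 := fun f hf => by simp [chainMap, Finsupp.mapDomain_single]
    change chainIntegral η (chainMap _ (contMDiff_slice hP 1) 1 (Finsupp.single σ 1)) -
      chainIntegral η (chainMap _ (contMDiff_slice hP 0) 1 (Finsupp.single σ 1)) =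
        Φ (boundary 0 (Finsupp.single σ 1))
    have hf0 : (σ.face 0).toFun 0 = σ.toFun fun _ => 1 := by
      rw [σ.face_apply 0 (zero_mem_stdSimp 0)]
      congr 1
      funext j
      fin_cases j
      simp only [faceIncl, Nat.reduceAdd]
      rw [Fin.sum_univ_one]
      simp [baryCoord]
    have hf1 : (σ.face 1).toFun 0 = σ.toFun 0 := by
      rw [σ.face_apply 1 (zero_mem_stdSimp 0)]
      congr 1
      funext j
      fin_cases j
      simp [faceIncl]
    rw [hmap, hmap, chainIntegral_single, chainIntegral_single, integral_map_slice_sub hP hη hker,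
      boundary_single, map_sum]
    simp only [map_zsmul, hΦ]
    refine Eq.trans ?_ (Fin.sum_univ_two _).symm
    rw [hf0, hf1]
    simp [sub_eq_add_neg]
  have h1 := DFunLike.congr_fun key γ
  have h2 : boundary 0 γ = 0 := hγ
  change chainIntegral η (chainMap _ (contMDiff_slice hP 1) 1 γ) -
    chainIntegral η (chainMap _ (contMDiff_slice hP 0) 1 γ) = Φ (boundary 0 γ) at h1
  rw [h2, map_zero] at h1
  exact sub_eq_zero.1 h1

end Homotopy

section ChangeOfVariables

variable {E : Type*} [NormedAddCommGroup E] [NormedSpace ℝ E] {H : Type*} [TopologicalSpace H]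
  {I : ModelWithCorners ℝ E H} {M : Type*} [TopologicalSpace M] [ChartedSpace H M]
  {E' : Type*} [NormedAddCommGroup E'] [NormedSpace ℝ E'] {H' : Type*} [TopologicalSpace H']
  {J : ModelWithCorners ℝ E' H'} {N : Type*} [TopologicalSpace N] [ChartedSpace H' N]

lemma SmoothSimplex.integral_map_eq_integral_pullback {k : ℕ} (Θ : DiffForm J N k) {f : M → N}
    (hf : ContMDiff I J ∞ f) (σ : SmoothSimplex I M k) :
    (σ.map f hf).integral Θ = σ.integral (DiffForm.pullback f Θ) := by
  refine MeasureTheory.setIntegral_congr_fun (measurableSet_stdSimp k) fun x hx => ?_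
  have h := DiffForm.pullbackWithin_pullback Θ (hf.mdifferentiable (by simp) (σ.toFun x))
    ((σ.smooth x hx).mdifferentiableWithinAt (by simp)) (uniqueDiffOn_stdSimp k x hx)
  exact (DFunLike.congr_fun h fun j => (Pi.single j (1 : ℝ) : Fin k → ℝ)).symm

lemma chainMap_single {k : ℕ} {f : M → N} (hf : ContMDiff I J ∞ f) (σ : SmoothSimplex I M k) :
    chainMap f hf k (Finsupp.single σ 1) = Finsupp.single (σ.map f hf) 1 := by
  simp [chainMap, Finsupp.mapDomain_single]

lemma chainIntegral_chainMap_eq_pullback {k : ℕ} (Θ : DiffForm J N k) {f : M → N}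
    (hf : ContMDiff I J ∞ f) (C : SmoothChain I M k) :
    chainIntegral Θ (chainMap f hf k C) = chainIntegral (DiffForm.pullback (I := I) f Θ) C := by
  have key : (chainIntegral Θ).comp (chainMap f hf k) =
      chainIntegral (DiffForm.pullback (I := I) f Θ) := by
    ext1 σ
    ext1
    change chainIntegral Θ (chainMap f hf k (Finsupp.single σ 1)) =
      chainIntegral (DiffForm.pullback (I := I) f Θ) (Finsupp.single σ 1)
    rw [chainMap_single, chainIntegral_single, chainIntegral_single,
      SmoothSimplex.integral_map_eq_integral_pullback]
  exact DFunLike.congr_fun key C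

end ChangeOfVariables

namespace MappingTorus

variable {E : Type*} [NormedAddCommGroup E] [NormedSpace ℝ E] {H : Type*} [TopologicalSpace H]
  {I : ModelWithCorners ℝ E H} {S : Type*} [TopologicalSpace S] [ChartedSpace H S]
  [IsManifold I ∞ S] [CompactSpace S] [T2Space S]

lemma contMDiff_proj (h : S ≃ₘ⟮I, I⟯ S) :
    ContMDiff (I.prod 𝓘(ℝ, ℝ)) (I.prod 𝓘(ℝ, ℝ)) ∞ (proj h) :=
  (isLocalDiffeomorph_proj h).contMDiff

/-- The flux of `h` vanishes as soon as `Ω` is the restriction to `S × {0}` of an exact form on the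
mapping torus with `∂_t` in its kernel. -/
theorem not_fluxNonzero {Ω : DiffForm I S 2} {h : S ≃ₘ⟮I, I⟯ S}
    {η : DiffForm (I.prod 𝓘(ℝ, ℝ)) (MappingTorus h) 1} (hη : η.Smooth)
    (hker : ∀ (p : S × ℝ) (w : E × ℝ),
      (DiffForm.pullback (I := I.prod 𝓘(ℝ, ℝ)) (proj h) η.extD) p ![((0, 1) : E × ℝ), w] = 0)
    (hres : DiffForm.pullback (I := I) (fun x : S => proj h (x, 0)) η.extD = Ω) :
    ¬ FluxNonzero Ω h := by
  rintro ⟨κ, hκ⟩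
  refine hκ ?_
  obtain ⟨-, hC⟩ := (exists_isCobordism h κ).choose_spec
  set C := (exists_isCobordism h κ).choose.2 with hCdef
  set c := (exists_isCobordism h κ).choose.1
  have h0 := contMDiff_slice (contMDiff_proj h) 0
  have h1 := contMDiff_slice (contMDiff_proj h) 1
  have hglue : chainMap _ h0 1 (chainMap h h.contMDiff 1 (c : SmoothChain I S 1)) =
      chainMap _ h1 1 (c : SmoothChain I S 1) := by
    have key : (chainMap _ h0 1).comp (chainMap h h.contMDiff 1) = chainMap _ h1 1 := by
      ext1 σ
      ext1
      change chainMap _ h0 1 (chainMap h h.contMDiff 1 (Finsupp.single σ 1)) =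
        chainMap _ h1 1 (Finsupp.single σ 1)
      rw [chainMap_single, chainMap_single, chainMap_single]
      congr 1
      ext x
      exact (proj_one h (σ.toFun x)).symm
    exact DFunLike.congr_fun key _
  have hzero : chainIntegral Ω C = 0 := by
    rw [← hres, ← chainIntegral_chainMap_eq_pullback _ h0, chainIntegral_extD hη,
      boundary_chainMap, hC, map_sub, map_sub, hglue,
      chainIntegral_slice_eq (contMDiff_proj h) hη hker c.2, sub_self]
  rw [flux, ← hCdef, hzero]
  rfl

/-- The restriction of `Ω_h` to `S × {0}` is `Ω`. -/
lemma pullback_slice_naturalForm {Ω : DiffForm I S 2} {h : S ≃ₘ⟮I, I⟯ S}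
    (hh : IsSymplectomorphism Ω h) :
    DiffForm.pullback (I := I) (fun x : S => proj h (x, 0)) (naturalForm h Ω) = Ω := by
  have hi : ContMDiff I (I.prod 𝓘(ℝ, ℝ)) ∞ fun x : S => (x, (0 : ℝ)) :=
    contMDiff_id.prodMk contMDiff_const
  have h1 := DiffForm.pullback_comp (naturalForm h Ω)
    ((contMDiff_proj h).mdifferentiable (by simp)) (hi.mdifferentiable (by simp))
  have h2 := DiffForm.pullback_comp (I := I) Ω (g := (Prod.fst : S × ℝ → S))
    mdifferentiable_fst (hi.mdifferentiable (by simp))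
  rw [pullback_naturalForm h hh, ← h2] at h1
  exact h1.trans (DiffForm.pullback_id Ω)

lemma pullback_proj_naturalForm_apply_ddt {Ω : DiffForm I S 2} {h : S ≃ₘ⟮I, I⟯ S}
    (hh : IsSymplectomorphism Ω h) (p : S × ℝ) (w : E × ℝ) :
    (DiffForm.pullback (I := I.prod 𝓘(ℝ, ℝ)) (proj h) (naturalForm h Ω)) p
      ![((0, 1) : E × ℝ), w] = 0 := by
  rw [pullback_naturalForm h hh]
  have h1 : mfderiv (I.prod 𝓘(ℝ, ℝ)) I (Prod.fst : S × ℝ → S) p =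
      ContinuousLinearMap.fst ℝ E ℝ := mfderiv_fst
  refine (Ω p.1).map_coord_zero (0 : Fin 2) ?_
  change mfderiv (I.prod 𝓘(ℝ, ℝ)) I (Prod.fst : S × ℝ → S) p ((0, 1) : E × ℝ) = 0
  rw [h1]
  rfl

lemma deRhamClass_naturalForm_ne_zero {Ω : DiffForm I S 2} {h : S ≃ₘ⟮I, I⟯ S}
    (hh : IsSymplectomorphism Ω h) (hflux : FluxNonzero Ω h)
    (hclosed : naturalForm h Ω ∈ closedForms (I.prod 𝓘(ℝ, ℝ)) (MappingTorus h) 2) :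
    deRhamClass ⟨naturalForm h Ω, hclosed⟩ ≠ 0 := by
  intro hzero
  obtain ⟨η, hη, hd⟩ : ∃ η : DiffForm (I.prod 𝓘(ℝ, ℝ)) (MappingTorus h) 1,
      η.Smooth ∧ naturalForm h Ω = η.extD := (Submodule.Quotient.mk_eq_zero _).1 hzero
  refine not_fluxNonzero hη (fun p w => ?_) ?_ hflux
  · rw [← hd]
    exact pullback_proj_naturalForm_apply_ddt hh p w
  · rw [← hd]
    exact pullback_slice_naturalForm hh

lemma not_isFirstReturnMapOfReeb {Ω : DiffForm I S 2} {h : S ≃ₘ⟮I, I⟯ S}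
    (hflux : FluxNonzero Ω h) : ¬ IsFirstReturnMapOfReeb h Ω := by
  rintro ⟨α, R, hα, hR, hres, hdir⟩
  refine not_fluxNonzero hα.smooth (fun p w => ?_) hres hflux
  obtain ⟨c, hc⟩ := hdir p
  obtain ⟨h1, h2⟩ := hR (proj h p)
  set D : (E × ℝ) →L[ℝ] E × ℝ := mfderiv (I.prod 𝓘(ℝ, ℝ)) (I.prod 𝓘(ℝ, ℝ)) (proj h) p
  set A : (E × ℝ) [⋀^Fin 1]→L[ℝ] ℝ := α (proj h p)
  set W : (E × ℝ) [⋀^Fin 2]→L[ℝ] ℝ := α.extD (proj h p)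
  have hRc : (R (proj h p) : E × ℝ) = c • D (0, 1) := hc
  have hc0 : c ≠ 0 := by
    rintro rfl
    have h3 : A ![(R (proj h p) : E × ℝ)] = 1 := h1
    rw [hRc, zero_smul, A.map_coord_zero (0 : Fin 1) rfl] at h3
    exact zero_ne_one h3
  have h4 : W ![c • D (0, 1), D w] = 0 := by
    rw [← hRc]
    exact h2 (D w)
  have h5 := W.map_pair_add_smul_left c 0 (D (0, 1)) 0 (D w)
  rw [smul_zero, add_zero, h4, zero_mul, add_zero] at h5
  have h6 : W ![D (0, 1), D w] = 0 := (mul_eq_zero.1 h5.symm).resolve_left hc0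
  refine Eq.trans ?_ h6
  refine congrArg W (funext fun j => ?_)
  fin_cases j <;> rfl

end MappingTorus

theorem lemma2p2 {E : Type*} [NormedAddCommGroup E] [NormedSpace ℝ E] [FiniteDimensional ℝ E]
    {H : Type*} [TopologicalSpace H] (I : ModelWithCorners ℝ E H)
    {S : Type*} [TopologicalSpace S] [ChartedSpace H S] [IsManifold I ∞ S]
    [CompactSpace S] [T2Space S]
    (Ω : DiffForm I S 2) (hΩ : IsSymplecticForm Ω) (hexact : Ω ∈ exactForms I S 2)
    (h : S ≃ₘ⟮I, I⟯ S) (hh : IsSymplectomorphism Ω h) (hflux : FluxNonzero Ω h) :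
    (∃ hclosed : MappingTorus.naturalForm h Ω ∈
        closedForms (I.prod 𝓘(ℝ, ℝ)) (MappingTorus h) 2,
      deRhamClass ⟨MappingTorus.naturalForm h Ω, hclosed⟩ ≠ 0) ∧
    ¬ MappingTorus.IsFirstReturnMapOfReeb h Ω := by
  have hclosed := MappingTorus.naturalForm_mem_closedForms hΩ.closed h hh
  exact ⟨⟨hclosed, MappingTorus.deRhamClass_naturalForm_ne_zero hh hflux hclosed⟩,
    MappingTorus.not_isFirstReturnMapOfReeb hflux⟩
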